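/- Let $n,\hat m\in\mathbb N$ with $\hat m\ge 1$. There is a function $L:[0,\infty)\to[0,\infty)$, depending only on $n$ and $\hat m$, such that the following holds. Let $p\in[1,\infty]$, let $T\subset\mathbb R^s$ be a bounded Lipschitz domain, and let $(\phi_i)_{i\in I}$ be a finite Lagrangian nodal basis of polynomial order $r$ on $T$: the $\phi_i$ are polynomials, there are Lagrange points $\xi_i\in\overline T$ with $\phi_i(\xi_j)=\delta_{ij}$, and $\sum_{i} q(\xi_i)\phi_i=q$ for every polynomial $q$ of degree at most $r$. Then there is a constant $C$, depending only on $n,\hat m,s,p,T$ and $(\phi_i)_{i\in I}$, such that for all $M$, $\delta$, $\rho$ and $(c_i)_{i\in I}$ as follows the estimate below holds. Let $M\subset\mathbb R^n$ be a closed embedded submanifold (of class $C^1$) and $\delta>0$ such that the closest-point projection $P(q)=\operatorname{argmin}_{r\in M}\|r-q\|$ is well defined on the $\delta$-neighborhood $U_\delta=\{q:\operatorname{dist}(q,M)<\delta\}$ and belongs to $W^{\hat m+1,\infty}(U_\delta;\mathbb R^n)$. Let $(c_i)_{i\in I}\subset M$ be nodal values contained in a ball of radius $\rho\ge0$ of $M$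 with respect to the geodesic distance, let $Q_{\mathbb R^n}v=\sum_{i\in I}c_i\phi_i$ be the function on $T$ interpolating them, assume $Q_{\mathbb R^n}v(T)\subset U_\delta$, and set $Q_Mv=P\circ Q_{\mathbb R^n}v$. Then, with $L(P)=L\big(\|P\|_{W^{\hat m+1,\infty}(U_\delta)}\big)$, $$ |Q_Mv|_{W^{\hat m,p}(T)}\le |Q_{\mathbb R^n}v|_{W^{\hat m,p}(T)} +C\,\rho\,L(P)\Big(|Q_{\mathbb R^n}v|_{W^{\hat m,p}(T)}+\max\big\{|Q_{\mathbb R^n}v|_{W^{1,\hat mp}(T)}^{\hat m},\,|Q_{\mathbb R^n}v|_{W^{1,\hat mp}(T)}\big\}\Big). $$ Here $|f|_{W^{k,q}(T)}=\big(\sum_{|a|=k}\|D^af\|_{L^q(T)}^q\big)^{1/q}$, and $|f|_{W^{k,\infty}(T)}=\max_{|a|=k}\|D^af\|_{L^\infty(T)}$, with weak derivatives $D^a$ and the Euclidean norm on $\mathbb R^n$ (the left-hand side counts as $\infty$ if a derivative is missing); the full norm is defined in the same way with $|a|\le k$. -/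

import Mathlib

open scoped ENNReal NNReal

namespace ProjFE

/-- `ℝ^s` with its Euclidean norm. -/
abbrev E (s : ℕ) : Type := EuclideanSpace ℝ (Fin s)

noncomputable section

/-! ### Weak derivatives, Sobolev seminorms and norms -/

/-- The `j`-th classical partial derivative. -/
def partialDeriv {s : ℕ} (j : Fin s) (η : E s → ℝ) : E s → ℝ :=
  fun x => fderiv ℝ η x (EuclideanSpace.single j 1)

/-- The classical derivative `D^a η` for a multi-index `a`: in each direction `j`, the `j`-th partial
derivative is taken `a j` times. (It is used for smooth `η` only.) -/
def multiDeriv {s : ℕ} (a : Fin s → ℕ) (η : E s → ℝ) : E s → ℝ :=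
  (List.finRange s).foldr (fun j ζ => (partialDeriv j)^[a j] ζ) η

/-- `g` is the weak derivative `D^a f` on the open set `U`. -/
structure HasWeakDeriv {s n : ℕ} (a : Fin s → ℕ) (U : Set (E s)) (f g : E s → E n) : Prop where
  locInt : MeasureTheory.LocallyIntegrableOn f U
  locInt_deriv : MeasureTheory.LocallyIntegrableOn g U
  integral_eq : ∀ η : E s → ℝ, ContDiff ℝ (⊤ : ℕ∞) η → HasCompactSupport η → tsupport η ⊆ U →
    ∫ x in U, multiDeriv a η x • f x = (-1 : ℝ) ^ (∑ j, a j) • ∫ x in U, η x • g x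

/-- The `L^p(U)`-norm of the weak derivative `D^a f`, with values in `[0, ∞]`. It is `∞` if there is
no such weak derivative; otherwise the weak derivative is unique almost everywhere and the infimum
is over a single value. -/
def weakDerivNorm {s n : ℕ} (a : Fin s → ℕ) (p : ℝ≥0∞) (U : Set (E s)) (f : E s → E n) : ℝ≥0∞ :=
  ⨅ (g : E s → E n) (_ : HasWeakDeriv a U f g),
    MeasureTheory.eLpNorm g p (MeasureTheory.volume.restrict U)

/-- `(∑_{a ∈ A} ‖D^a f‖_{L^p(U)}^p)^{1/p}`, and `max_{a ∈ A} ‖D^a f‖_{L^∞(U)}` for `p = ∞`. -/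
def sobolevSum {s n : ℕ} (A : Finset (Fin s → ℕ)) (p : ℝ≥0∞) (U : Set (E s)) (f : E s → E n) :
    ℝ≥0∞ :=
  if p = ∞ then A.sup (fun a => weakDerivNorm a p U f)
  else (∑ a ∈ A, weakDerivNorm a p U f ^ p.toReal) ^ (1 / p.toReal)

/-- The multi-indices `a` with `|a| = k`. -/
def multiIndices (s k : ℕ) : Finset (Fin s → ℕ) := Finset.piAntidiag Finset.univ k

/-- The multi-indices `a` with `|a| ≤ k`. -/
def multiIndicesLE (s k : ℕ) : Finset (Fin s → ℕ) :=
  (Finset.range (k + 1)).biUnion (multiIndices s)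

/-- The seminorm `|f|_{W^{k,p}(U)}`, with values in `[0, ∞]`; it is finite if and only if all weak
derivatives of order `k` exist and lie in `L^p(U)`. -/
def sobolevSeminorm {s n : ℕ} (k : ℕ) (p : ℝ≥0∞) (U : Set (E s)) (f : E s → E n) : ℝ≥0∞ :=
  sobolevSum (multiIndices s k) p U f

/-- The norm `‖f‖_{W^{k,p}(U)}`, with values in `[0, ∞]`. -/
def sobolevNorm {s n : ℕ} (k : ℕ) (p : ℝ≥0∞) (U : Set (E s)) (f : E s → E n) : ℝ≥0∞ :=
  sobolevSum (multiIndicesLE s k) p U f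

/-- `f ∈ W^{k,p}(U)`. -/
def MemSobolev {s n : ℕ} (k : ℕ) (p : ℝ≥0∞) (U : Set (E s)) (f : E s → E n) : Prop :=
  sobolevNorm k p U f < ∞

/-! ### Lipschitz domains -/

/-- A bounded Lipschitz domain: a bounded, connected, nonempty open set which near every boundary
point is, in the direction of some unit vector `e`, the strict epigraph of a Lipschitz function of
the coordinates orthogonal to `e`. -/
structure IsLipschitzDomain {s : ℕ} (T : Set (E s)) : Prop where
  isOpen : IsOpen T
  isConnected : IsConnected T
  isBounded : Bornology.IsBounded T
  lipschitz_boundary : ∀ x ∈ frontier T, ∃ (r : ℝ) (e : E s) (K : ℝ≥0) (g : E s → ℝ),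
    0 < r ∧ ‖e‖ = 1 ∧ LipschitzWith K g ∧
      ∀ y ∈ Metric.ball x r, (y ∈ T ↔ g (y - inner ℝ e y • e) < inner ℝ e y)

/-! ### Submanifolds, geodesic distance, closest-point projection -/

/-- `M` is an embedded `C^1`-submanifold of `ℝ^n` (without boundary): around each of its points
a local `C^1`-diffeomorphism of `ℝ^n` flattens it to a coordinate subspace of dimension `d`. -/
def IsEmbeddedSubmanifold {n : ℕ} (M : Set (E n)) : Prop :=
  ∃ d : ℕ, d ≤ n ∧ ∀ x ∈ M, ∃ Φ : OpenPartialHomeomorph (E n) (E n), x ∈ Φ.source ∧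
    ContDiffOn ℝ 1 Φ Φ.source ∧ ContDiffOn ℝ 1 Φ.symm Φ.target ∧
      ∀ y ∈ Φ.source, (y ∈ M ↔ ∀ i : Fin n, d ≤ (i : ℕ) → Φ y i = 0)

/-- The geodesic distance of `M`: the infimum of the lengths of the `C^1`-curves in `M` from `x`
to `y` (`∞` if there is none). -/
def geodesicDist {n : ℕ} (M : Set (E n)) (x y : E n) : ℝ≥0∞ :=
  ⨅ (γ : ℝ → E n) (_ : ContDiffOn ℝ 1 γ (Set.Icc 0 1) ∧ Set.MapsTo γ (Set.Icc 0 1) M ∧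
    γ 0 = x ∧ γ 1 = y), ∫⁻ t in Set.Icc (0 : ℝ) 1, ‖deriv γ t‖ₑ

/-- The (closed) ball of `M` for the geodesic distance. -/
def geodesicBall {n : ℕ} (M : Set (E n)) (z : E n) (ρ : ℝ≥0) : Set (E n) :=
  {y | y ∈ M ∧ geodesicDist M z y ≤ ρ}

/-- On `U`, the closest-point projection `q ↦ argmin_{r ∈ M} ‖r - q‖` onto `M` is well defined, and
`P` is this map. -/
def IsClosestPointProjection {n : ℕ} (M U : Set (E n)) (P : E n → E n) : Prop :=
  ∀ q ∈ U, {r | r ∈ M ∧ ∀ r' ∈ M, ‖r - q‖ ≤ ‖r' - q‖} = {P q}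

/-! ### Lagrange interpolation -/

/-- The value at a point of `ℝ^s` of a real polynomial in `s` variables. -/
def polyEval {s : ℕ} (q : MvPolynomial (Fin s) ℝ) (x : E s) : ℝ :=
  MvPolynomial.eval (fun j => x j) q

/-- `φ` is a Lagrangian nodal basis of order `r` on `T` with the Lagrange points `ξ`: the `φ i` are
polynomials with `φ i (ξ j) = δ_{ij}`, and the interpolation `q ↦ ∑ i, q (ξ i) φ i` reproduces the
polynomials `q` of degree at most `r`. -/
structure IsLagrangeBasis {s N : ℕ} (T : Set (E s)) (r : ℕ) (ξ : Fin N → E s)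
    (φ : Fin N → MvPolynomial (Fin s) ℝ) : Prop where
  node_mem : ∀ i, ξ i ∈ closure T
  eval_node : ∀ i j, polyEval (φ i) (ξ j) = if i = j then 1 else 0
  reproduces : ∀ q : MvPolynomial (Fin s) ℝ, q.totalDegree ≤ r →
    ∑ i, MvPolynomial.C (polyEval q (ξ i)) * φ i = q

/-- The interpolating function `Q_{ℝ^n} v = ∑ i, c_i φ_i` of the nodal values `c_i = v (ξ_i)`. -/
def euclInterp {s n N : ℕ} (φ : Fin N → MvPolynomial (Fin s) ℝ) (c : Fin N → E n) : E s → E n :=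
  fun x => ∑ i, polyEval (φ i) x • c i

/-- The projected interpolating function `Q_M v = P ∘ Q_{ℝ^n} v`. -/
def projInterp {s n N : ℕ} (P : E n → E n) (φ : Fin N → MvPolynomial (Fin s) ℝ)
    (c : Fin N → E n) : E s → E n :=
  fun x => P (euclInterp φ c x)

end

end ProjFE

/-!
Write `Q` for the interpolating function and `B` for the norm of `P` in `W^{m+1,∞}`. The function
`L` can be taken to be the identity.

**Regularity of `P`.** A closest-point projection onto a closed set is continuous where it is well
defined. A continuous function in `W^{m+1,∞}` is of class `C^m`, its derivatives up to order `m` are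
bounded by a multiple of `B`, and its first derivative is Lipschitz along segments with such a
constant (`contDiffOn_of_weakDerivNorm_le`). The core is that a function with bounded weak partial
derivatives agrees almost everywhere locally with a Lipschitz function: its mollifications have
derivatives with the same bound (`norm_fderiv_mollify_le`) and converge almost everywhere. Applied
to the difference with an affine function, the same estimate shows that continuous weak partial
derivatives are classical ones (`hasFDerivAt_of_continuousOn_weak`).
Hence `P ∘ Q` is of class `C^m` and its Sobolev seminorm is computed from classical derivatives.

**The linear part.** The derivative of order `m` of `P ∘ Q` is `DP(Q) D^m Q` plus a remainder. At
a point of `M` the derivative of `P` is idempotent, because `P ∘ P = P`, and has nonnegative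
quadratic form, because `P` is a monotone operator. So it is an orthogonal projection and has norm
at most one. The distance from `Q x` to `P (Q x)` is at most that from `Q x` to the centre `z` of
the ball, which is a multiple of `ρ` since the basis functions add up to one. The Lipschitz bound
therefore gives `‖DP(Q x)‖ ≤ 1 + C ρ B`.

**The remainder.** It only contains products of at least two derivatives of `Q`
(`norm_iteratedFDeriv_comp_sub_le`). Each derivative of order between `1` and `m` is at most a
multiple of `ρ`, again by subtracting `z`. It is also at most a multiple of the seminorm
`α = |Q|_{W^{1,mp}}`: the interpolating functions form a finite-dimensional space, and modulo
functions with vanishing gradient all norms on it are equivalent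
(`exists_enorm_iteratedFDeriv_euclInterp_le`). Using the first bound for one factor and the second
for the others bounds the remainder by a multiple of `ρ B max (α ^ m) α`.

The weighted sum over multi-indices is then estimated with Minkowski's inequality in `L^p` and
`ℓ^p`.
-/

open MeasureTheory

namespace ProjFE

noncomputable section

/-! ### Iterated partial derivatives along a list of directions -/

/-- The iterated partial derivative of a vector-valued function along a list of coordinate
directions; the head of the list is the outermost derivative. -/
def listDeriv {s : ℕ} {F : Type*} [NormedAddCommGroup F] [NormedSpace ℝ F]
    (l : List (Fin s)) (f : E s → F) : E s → F :=
  l.foldr (fun j g x => fderiv ℝ g x (EuclideanSpace.single j 1)) f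

/-- The list of directions of a multi-index: `j` occurs `a j` times. -/
def multiList {s : ℕ} (a : Fin s → ℕ) : List (Fin s) :=
  (List.finRange s).flatMap fun j => List.replicate (a j) j

section listDeriv

variable {s : ℕ} {F : Type*} [NormedAddCommGroup F] [NormedSpace ℝ F]

@[simp] lemma listDeriv_nil (f : E s → F) : listDeriv [] f = f := rfl

lemma listDeriv_cons (j : Fin s) (l : List (Fin s)) (f : E s → F) :
    listDeriv (j :: l) f =
      fun x => fderiv ℝ (listDeriv l f) x (EuclideanSpace.single j 1) := rfl

lemma listDeriv_append (l l' : List (Fin s)) (f : E s → F) :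
    listDeriv (l ++ l') f = listDeriv l (listDeriv l' f) := by
  simp [listDeriv]

lemma multiDeriv_eq_listDeriv (a : Fin s → ℕ) (η : E s → ℝ) :
    multiDeriv a η = listDeriv (multiList a) η := by
  have hrep : ∀ (j : Fin s) (k : ℕ) (ζ : E s → ℝ),
      (partialDeriv j)^[k] ζ = listDeriv (List.replicate k j) ζ := by
    intro j k ζ
    induction k with
    | zero => rfl
    | succ k ih => rw [Function.iterate_succ_apply', ih, List.replicate_succ]; rfl
  unfold multiDeriv multiList
  induction List.finRange s with
  | nil => rfl
  | cons j l ih => rw [List.foldr_cons, ih, hrep, List.flatMap_cons, listDeriv_append]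

lemma length_multiList (a : Fin s → ℕ) : (multiList a).length = ∑ j, a j := by
  simp [multiList, List.length_flatMap, ← List.ofFn_eq_map, List.sum_ofFn]

lemma count_multiList (a : Fin s → ℕ) (j : Fin s) : (multiList a).count j = a j := by
  rw [multiList, List.count_flatMap]
  have : (List.map (List.count j ∘ fun j => List.replicate (a j) j) (List.finRange s)).sum
      = ∑ i, if i = j then a i else 0 := by
    rw [← List.ofFn_eq_map, List.sum_ofFn]
    simp [List.count_replicate]
  rw [this]; simp

lemma contDiff_listDeriv (l : List (Fin s)) {f : E s → F} (hf : ContDiff ℝ (⊤ : ℕ∞) f) :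
    ContDiff ℝ (⊤ : ℕ∞) (listDeriv l f) := by
  induction l with
  | nil => exact hf
  | cons j l ih => exact (ih.fderiv_right (m := (⊤ : ℕ∞)) (by simp)).clm_apply contDiff_const

lemma tsupport_listDeriv_subset (l : List (Fin s)) (f : E s → F) :
    tsupport (listDeriv l f) ⊆ tsupport f := by
  induction l with
  | nil => exact subset_rfl
  | cons j l ih =>
    exact (tsupport_fderiv_apply_subset ℝ _).trans ih

/-- Partial derivatives of smooth functions commute. -/
lemma listDeriv_perm {l l' : List (Fin s)} (h : l.Perm l') {f : E s → F}
    (hf : ContDiff ℝ (⊤ : ℕ∞) f) : listDeriv l f = listDeriv l' f := by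
  induction h with
  | nil => rfl
  | cons j _ ih => rw [listDeriv_cons, ih]; rfl
  | swap i j l =>
    have hg := contDiff_listDeriv l hf
    ext x
    have hd : DifferentiableAt ℝ (fderiv ℝ (listDeriv l f)) x :=
      (hg.fderiv_right (m := (⊤ : ℕ∞)) (by simp)).differentiable (by simp) x
    have key : ∀ i j : Fin s, listDeriv (i :: j :: l) f x =
        fderiv ℝ (fderiv ℝ (listDeriv l f)) x (EuclideanSpace.single i 1)
          (EuclideanSpace.single j 1) := by
      intro i j
      simp only [listDeriv_cons]
      rw [fderiv_clm_apply hd (differentiableAt_const _)]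
      simp
    rw [key, key]
    exact (hg.contDiffAt.isSymmSndFDerivAt
      (by rw [minSmoothness_of_isRCLikeNormedField]; exact WithTop.coe_le_coe.2 le_top)) _ _
  | trans _ _ ih1 ih2 => exact ih1.trans ih2

/-- Along a `C^k` function the iterated partial derivatives are the values of the iterated Fréchet
derivative on basis vectors. -/
lemma listDeriv_eq_iteratedFDeriv {U : Set (E s)} (hU : IsOpen U) {f : E s → F}
    (l : List (Fin s)) (hf : ContDiffOn ℝ l.length f U) {x : E s} (hx : x ∈ U) :
    listDeriv l f x =
      iteratedFDeriv ℝ l.length f x (fun i => EuclideanSpace.single (l.get i) 1) := by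
  induction l generalizing x with
  | nil => simp
  | cons j l ih =>
    have hf' : ContDiffOn ℝ l.length f U := hf.of_le (by simp)
    have heq : listDeriv l f =ᶠ[nhds x] fun y => iteratedFDeriv ℝ l.length f y
        (fun i => EuclideanSpace.single (l.get i) 1) := by
      filter_upwards [hU.mem_nhds hx] with y hy using ih hf' hy
    have hd : DifferentiableAt ℝ (iteratedFDeriv ℝ l.length f) x := by
      refine (hf.contDiffAt (hU.mem_nhds hx)).differentiableAt_iteratedFDeriv ?_
      simp only [List.length_cons]
      exact_mod_cast Nat.lt_succ_self _
    rw [listDeriv_cons]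
    simp only [List.length_cons]
    rw [heq.fderiv_eq, iteratedFDeriv_succ_apply_left]
    have := (hd.hasFDerivAt.continuousMultilinear_apply_const
      (fun i => EuclideanSpace.single (l.get i) (1 : ℝ))).fderiv
    rw [this]
    rfl

lemma listDeriv_eq_iteratedFDeriv_of_length {U : Set (E s)} (hU : IsOpen U) {f : E s → F}
    (l : List (Fin s)) {k : ℕ} (hl : l.length = k) (hf : ContDiffOn ℝ k f U) {x : E s}
    (hx : x ∈ U) :
    listDeriv l f x = iteratedFDeriv ℝ k f x
      (fun i => EuclideanSpace.single (l.get (Fin.cast hl.symm i)) 1) := by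
  subst hl
  exact listDeriv_eq_iteratedFDeriv hU l hf hx

lemma contDiffOn_fderiv_single {U : Set (E s)} (hU : IsOpen U) {f : E s → F} {k : ℕ}
    (hf : ContDiffOn ℝ (k + 1 : ℕ) f U) (j : Fin s) :
    ContDiffOn ℝ k (fun x => fderiv ℝ f x (EuclideanSpace.single j 1)) U :=
  (hf.fderiv_of_isOpen hU (by norm_cast)).clm_apply contDiffOn_const

lemma continuousOn_listDeriv {U : Set (E s)} (hU : IsOpen U) {f : E s → F}
    (l : List (Fin s)) (hf : ContDiffOn ℝ l.length f U) : ContinuousOn (listDeriv l f) U := by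
  have : ContinuousOn (fun x => iteratedFDeriv ℝ l.length f x
      (fun i => EuclideanSpace.single (l.get i) (1 : ℝ))) U := by
    have h := (hf.continuousOn_iteratedFDerivWithin le_rfl hU.uniqueDiffOn).congr
      (fun x hx => (iteratedFDerivWithin_of_isOpen _ hU hx).symm)
    exact (ContinuousMultilinearMap.apply ℝ (fun _ : Fin l.length => E s) F
      _).continuous.comp_continuousOn h
  exact this.congr fun x hx => listDeriv_eq_iteratedFDeriv hU l hf hx

end listDeriv

/-! ### Weak derivatives: integration by parts and uniqueness -/

section weak

variable {s n : ℕ}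

/-- The product of a test function with a function that is `C^1` only near its support is
differentiable everywhere. -/
lemma hasFDerivAt_smul_of_tsupport {F : Type*} [NormedAddCommGroup F] [NormedSpace ℝ F]
    {U : Set (E s)} (hU : IsOpen U) {f : E s → F} (hf : ContDiffOn ℝ 1 f U)
    {η : E s → ℝ} (hη : ContDiff ℝ (⊤ : ℕ∞) η) (hηU : tsupport η ⊆ U) (x : E s) :
    HasFDerivAt (fun y => η y • f y) (η x • fderiv ℝ f x + (fderiv ℝ η x).smulRight (f x)) x := by
  by_cases hx : x ∈ U
  · have h1 := (hη.differentiable (by simp) x).hasFDerivAt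
    have h2 := ((hf.contDiffAt (hU.mem_nhds hx)).differentiableAt (by simp)).hasFDerivAt
    exact h1.smul h2
  · have hx' : x ∉ tsupport η := fun h => hx (hηU h)
    have h0 : η =ᶠ[nhds x] 0 := notMem_tsupport_iff_eventuallyEq.1 hx'
    have h1 : (fun y => η y • f y) =ᶠ[nhds x] fun _ => (0 : F) := by
      filter_upwards [h0] with y hy
      simp [hy]
    have h2 : fderiv ℝ η x = 0 := by rw [h0.fderiv_eq]; simp
    rw [h2, h0.eq_of_nhds]
    simpa using (hasFDerivAt_const (0 : F) x).congr_of_eventuallyEq h1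

lemma continuous_smul_of_tsupport {F : Type*} [NormedAddCommGroup F] [NormedSpace ℝ F]
    {U : Set (E s)} (hU : IsOpen U) {f : E s → F} (hf : ContinuousOn f U)
    {η : E s → ℝ} (hη : Continuous η) (hηU : tsupport η ⊆ U) :
    Continuous fun y => η y • f y := by
  rw [continuous_iff_continuousAt]
  intro x
  by_cases hx : x ∈ U
  · exact hη.continuousAt.smul (hf.continuousAt (hU.mem_nhds hx))
  · have h0 : η =ᶠ[nhds x] 0 := notMem_tsupport_iff_eventuallyEq.1 fun h => hx (hηU h)
    refine (continuousAt_const (y := (0 : F))).congr ?_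
    filter_upwards [h0] with y hy
    simp [hy]

lemma setIntegral_smul_of_tsupport {F : Type*} [NormedAddCommGroup F] [NormedSpace ℝ F]
    {U : Set (E s)} {f : E s → F} {η : E s → ℝ} (hηU : tsupport η ⊆ U) :
    ∫ x in U, η x • f x = ∫ x, η x • f x := by
  refine setIntegral_eq_integral_of_forall_compl_eq_zero fun x hx => ?_
  rw [image_eq_zero_of_notMem_tsupport fun h => hx (hηU h), zero_smul]

lemma integrable_test_smul {F : Type*} [NormedAddCommGroup F] [NormedSpace ℝ F]
    {U : Set (E s)} {f : E s → F} (hf : LocallyIntegrableOn f U)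
    {η : E s → ℝ} (hη : Continuous η) (hc : HasCompactSupport η) (hηU : tsupport η ⊆ U) :
    Integrable fun y => η y • f y := by
  have h : IntegrableOn (fun y => η y • f y) (tsupport η) :=
    (hf.integrableOn_compact_subset hηU hc).continuousOn_smul hη.continuousOn hc
  refine (integrableOn_iff_integrable_of_support_subset fun x hx => ?_).1 h
  exact subset_tsupport _ fun h0 => hx (by simp [h0])

lemma integrable_smul_of_tsupport {F : Type*} [NormedAddCommGroup F] [NormedSpace ℝ F]
    {U : Set (E s)} (hU : IsOpen U) {f : E s → F} (hf : ContinuousOn f U)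
    {η : E s → ℝ} (hη : Continuous η) (hc : HasCompactSupport η) (hηU : tsupport η ⊆ U) :
    Integrable fun y => η y • f y :=
  (continuous_smul_of_tsupport hU hf hη hηU).integrable_of_hasCompactSupport hc.smul_right

lemma integral_partial_smul {F : Type*} [NormedAddCommGroup F] [NormedSpace ℝ F]
    {U : Set (E s)} (hU : IsOpen U) {f : E s → F} (hf : ContDiffOn ℝ 1 f U)
    {η : E s → ℝ} (hη : ContDiff ℝ (⊤ : ℕ∞) η) (hc : HasCompactSupport η) (hηU : tsupport η ⊆ U)
    (v : E s) :
    ∫ x in U, fderiv ℝ η x v • f x = - ∫ x in U, η x • fderiv ℝ f x v := by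
  have hts : tsupport (fun x => fderiv ℝ η x v) ⊆ U :=
    (tsupport_fderiv_apply_subset ℝ v).trans hηU
  rw [setIntegral_smul_of_tsupport hts, setIntegral_smul_of_tsupport hηU]
  have hcd : Continuous fun x => fderiv ℝ η x v :=
    (hη.continuous_fderiv (by simp)).clm_apply continuous_const
  have hcf : ContinuousOn (fun x => fderiv ℝ f x v) U :=
    (hf.continuousOn_fderiv_of_isOpen hU le_rfl).clm_apply continuousOn_const
  have i1 := integrable_smul_of_tsupport hU hf.continuousOn hcd (hc.fderiv_apply ℝ v) hts
  have i2 := integrable_smul_of_tsupport hU hcf hη.continuous hc hηU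
  have i3 := integrable_smul_of_tsupport hU hf.continuousOn hη.continuous hc hηU
  rw [← sub_eq_zero, sub_neg_eq_add, ← integral_add i1 i2]
  have key := integral_bilinear_hasLineDerivAt_right_eq_neg_left_of_integrable
    (μ := (volume : Measure (E s))) (f := fun _ => (1 : ℝ)) (f' := fun _ => (0 : ℝ))
    (g := fun y => η y • f y)
    (g' := fun x => η x • fderiv ℝ f x v + fderiv ℝ η x v • f x) (v := v)
    (B := ContinuousLinearMap.lsmul ℝ ℝ) (by simp)
    (by simpa using! i2.add i1) (by simpa using i3)
    (fun x _ => by simpa using (hasFDerivAt_const (1 : ℝ) x).hasLineDerivAt v)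
    (fun x _ => by simpa using (hasFDerivAt_smul_of_tsupport hU hf hη hηU x).hasLineDerivAt v)
  simpa [add_comm] using key

lemma integral_listDeriv_smul {F : Type*} [NormedAddCommGroup F] [NormedSpace ℝ F]
    {U : Set (E s)} (hU : IsOpen U) (l : List (Fin s)) {f : E s → F}
    (hf : ContDiffOn ℝ l.length f U)
    {η : E s → ℝ} (hη : ContDiff ℝ (⊤ : ℕ∞) η) (hc : HasCompactSupport η)
    (hηU : tsupport η ⊆ U) :
    ∫ x in U, listDeriv l η x • f x =
      (-1 : ℝ) ^ l.length • ∫ x in U, η x • listDeriv l.reverse f x := by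
  induction l generalizing f with
  | nil => simp
  | cons j l ih =>
    have h1 : ContDiffOn ℝ 1 f U := hf.of_le (by simp)
    have hsub := tsupport_listDeriv_subset l η
    have := integral_partial_smul hU h1 (contDiff_listDeriv l hη)
      (hc.of_isClosed_subset (isClosed_tsupport _) hsub) (hsub.trans hηU)
      (EuclideanSpace.single j 1)
    rw [listDeriv_cons, this, ih (contDiffOn_fderiv_single hU hf j), List.reverse_cons,
      listDeriv_append, List.length_cons, pow_succ, mul_neg_one, neg_smul]
    rfl

/-- The weak derivatives of a `C^k` function are the classical ones. -/
lemma hasWeakDeriv_of_contDiffOn {U : Set (E s)} (hU : IsOpen U) (a : Fin s → ℕ)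
    {f : E s → E n} (hf : ContDiffOn ℝ (∑ j, a j : ℕ) f U) :
    HasWeakDeriv a U f (listDeriv (multiList a).reverse f) where
  locInt := hf.continuousOn.locallyIntegrableOn hU.measurableSet
  locInt_deriv := by
    refine (continuousOn_listDeriv hU _ ?_).locallyIntegrableOn hU.measurableSet
    rwa [List.length_reverse, length_multiList]
  integral_eq η hη hc hηU := by
    rw [multiDeriv_eq_listDeriv, ← length_multiList a]
    exact integral_listDeriv_smul hU _ (by rwa [length_multiList]) hη hc hηU

lemma HasWeakDeriv.ae_eq {U : Set (E s)} (hU : IsOpen U) {a : Fin s → ℕ} {f g g' : E s → E n}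
    (h : HasWeakDeriv a U f g) (h' : HasWeakDeriv a U f g') :
    g =ᵐ[volume.restrict U] g' := by
  have key : ∀ᵐ x, x ∈ U → (g - g') x = 0 := by
    refine hU.ae_eq_zero_of_integral_contDiff_smul_eq_zero (h.locInt_deriv.sub h'.locInt_deriv) ?_
    intro η hη hc hηU
    have e1 := h.integral_eq η hη hc hηU
    have e2 := h'.integral_eq η hη hc hηU
    rw [e1] at e2
    have e3 := smul_right_injective (E n) (pow_ne_zero (∑ j, a j) (by norm_num : (-1 : ℝ) ≠ 0)) e2
    rw [setIntegral_smul_of_tsupport hηU, setIntegral_smul_of_tsupport hηU] at e3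
    have i1 : Integrable fun x => η x • g x :=
      integrable_test_smul h.locInt_deriv hη.continuous hc hηU
    have i2 : Integrable fun x => η x • g' x :=
      integrable_test_smul h'.locInt_deriv hη.continuous hc hηU
    simp only [Pi.sub_apply, smul_sub]
    rw [integral_sub i1 i2, e3, sub_self]
  rw [Filter.EventuallyEq, ae_restrict_iff' hU.measurableSet]
  filter_upwards [key] with x hx hxU
  exact sub_eq_zero.1 (hx hxU)

lemma weakDerivNorm_eq {U : Set (E s)} (hU : IsOpen U) {a : Fin s → ℕ} {f g : E s → E n}
    (h : HasWeakDeriv a U f g) (p : ℝ≥0∞) :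
    weakDerivNorm a p U f = eLpNorm g p (volume.restrict U) := by
  refine le_antisymm (iInf₂_le g h) (le_iInf₂ fun g' h' => ?_)
  exact (eLpNorm_congr_ae (h.ae_eq hU h')).le

end weak

/-! ### Bounded weak partial derivatives and Lipschitz representatives -/

section lipschitz

variable {s n : ℕ}

lemma multiList_single (j : Fin s) : multiList (Pi.single j 1 : Fin s → ℕ) = [j] := by
  refine List.perm_singleton.1 (List.perm_iff_count.2 fun i => ?_)
  rw [count_multiList, Pi.single_apply, List.count_singleton]
  by_cases h : i = j
  · simp [h]
  · simp [h, Ne.symm h]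

lemma multiDeriv_single_add (a : Fin s → ℕ) (j : Fin s) {η : E s → ℝ}
    (hη : ContDiff ℝ (⊤ : ℕ∞) η) :
    multiDeriv (a + Pi.single j 1) η = multiDeriv a (partialDeriv j η) := by
  have h : multiDeriv a (partialDeriv j η) = listDeriv (multiList a ++ [j]) η := by
    rw [listDeriv_append, multiDeriv_eq_listDeriv]; rfl
  rw [h, multiDeriv_eq_listDeriv]
  refine listDeriv_perm (List.perm_iff_count.2 fun i => ?_) hη
  rw [List.count_append, count_multiList, count_multiList, Pi.add_apply, Pi.single_apply,
    List.count_singleton]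
  by_cases h : i = j
  · simp [h]
  · simp [h, Ne.symm h]

lemma multiList_zero : multiList (0 : Fin s → ℕ) = [] :=
  List.eq_nil_of_length_eq_zero (by rw [length_multiList]; simp)

lemma multiDeriv_zero (η : E s → ℝ) : multiDeriv 0 η = η := by
  rw [multiDeriv_eq_listDeriv]
  rw [multiList_zero]; rfl

lemma multiDeriv_single (j : Fin s) {η : E s → ℝ} (hη : ContDiff ℝ (⊤ : ℕ∞) η) :
    multiDeriv (Pi.single j 1) η = partialDeriv j η := by
  rw [← zero_add (Pi.single j 1), multiDeriv_single_add 0 j hη, multiDeriv_zero]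

lemma fderiv_eq_sum_partialDeriv (η : E s → ℝ) (x v : E s) :
    fderiv ℝ η x v = ∑ j, v j * partialDeriv j η x := by
  have hv : v = ∑ j, v j • EuclideanSpace.single j (1 : ℝ) := by
    ext i; simp [Finset.sum_apply, Pi.single_apply]
  conv_lhs => rw [hv]
  rw [map_sum]
  simp [partialDeriv]

lemma HasWeakDeriv.mono {a : Fin s → ℕ} {U V : Set (E s)} {f g : E s → E n}
    (h : HasWeakDeriv a U f g) (hV : V ⊆ U) : HasWeakDeriv a V f g where
  locInt := h.locInt.mono_set hV
  locInt_deriv := h.locInt_deriv.mono_set hV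
  integral_eq η hη hc hηV := by
    have hs : tsupport (multiDeriv a η) ⊆ tsupport η := by
      rw [multiDeriv_eq_listDeriv]; exact tsupport_listDeriv_subset _ _
    have := h.integral_eq η hη hc (hηV.trans hV)
    rw [setIntegral_smul_of_tsupport (hs.trans hηV), setIntegral_smul_of_tsupport hηV]
    rwa [setIntegral_smul_of_tsupport (hs.trans (hηV.trans hV)),
      setIntegral_smul_of_tsupport (hηV.trans hV)] at this

lemma HasWeakDeriv.congr {a : Fin s → ℕ} {U : Set (E s)} {f g f' g' : E s → E n}
    (h : HasWeakDeriv a U f g) (hf : f =ᵐ[volume.restrict U] f')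
    (hg : g =ᵐ[volume.restrict U] g') : HasWeakDeriv a U f' g' where
  locInt := h.locInt.congr hf
  locInt_deriv := h.locInt_deriv.congr hg
  integral_eq η hη hc hηU := by
    have e1 : ∫ x in U, multiDeriv a η x • f' x = ∫ x in U, multiDeriv a η x • f x :=
      integral_congr_ae (by filter_upwards [hf] with x hx; rw [hx])
    have e2 : ∫ x in U, η x • g' x = ∫ x in U, η x • g x :=
      integral_congr_ae (by filter_upwards [hg] with x hx; rw [hx])
    rw [e1, e2, h.integral_eq η hη hc hηU]

lemma HasWeakDeriv.sub {a : Fin s → ℕ} {U : Set (E s)} {f g f' g' : E s → E n}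
    (h : HasWeakDeriv a U f g) (h' : HasWeakDeriv a U f' g') :
    HasWeakDeriv a U (f - f') (g - g') where
  locInt := h.locInt.sub h'.locInt
  locInt_deriv := h.locInt_deriv.sub h'.locInt_deriv
  integral_eq η hη hc hηU := by
    have hs : tsupport (multiDeriv a η) ⊆ tsupport η := by
      rw [multiDeriv_eq_listDeriv]; exact tsupport_listDeriv_subset _ _
    have hd : Continuous (multiDeriv a η) := by
      rw [multiDeriv_eq_listDeriv]; exact (contDiff_listDeriv _ hη).continuous
    have hcd := hc.of_isClosed_subset (isClosed_tsupport _) hs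
    simp only [Pi.sub_apply, smul_sub]
    rw [integral_sub (integrable_test_smul h.locInt hd hcd (hs.trans hηU)).integrableOn
        (integrable_test_smul h'.locInt hd hcd (hs.trans hηU)).integrableOn,
      integral_sub (integrable_test_smul h.locInt_deriv hη.continuous hc hηU).integrableOn
        (integrable_test_smul h'.locInt_deriv hη.continuous hc hηU).integrableOn,
      h.integral_eq η hη hc hηU, h'.integral_eq η hη hc hηU, smul_sub]

/-- The derivative of order `a + e_j` is the weak `j`-th partial derivative of the one of
order `a`. -/
lemma HasWeakDeriv.partial {a : Fin s → ℕ} {j : Fin s} {U : Set (E s)} {f g g' : E s → E n}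
    (h : HasWeakDeriv a U f g) (h' : HasWeakDeriv (a + Pi.single j 1) U f g') :
    HasWeakDeriv (Pi.single j 1) U g g' where
  locInt := h.locInt_deriv
  locInt_deriv := h'.locInt_deriv
  integral_eq η hη hc hηU := by
    have hs : tsupport (partialDeriv j η) ⊆ tsupport η := tsupport_fderiv_apply_subset ℝ _
    have e1 := h.integral_eq (partialDeriv j η) (contDiff_listDeriv [j] hη)
      (hc.of_isClosed_subset (isClosed_tsupport _) hs) (hs.trans hηU)
    have e2 := h'.integral_eq η hη hc hηU
    rw [multiDeriv_single_add a j hη, e1] at e2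
    have h0 : (-1 : ℝ) ^ (∑ j, a j) ≠ 0 := pow_ne_zero _ (by norm_num)
    rw [multiDeriv_single j hη]
    refine smul_right_injective (E n) h0 ?_
    simp only
    rw [e2, smul_smul, ← pow_add]
    simp [Finset.sum_add_distrib]

/-- The derivative of a mollification of `f` is controlled by the weak partial derivatives of `f`:
differentiating the kernel amounts to testing the weak derivatives with the translated kernel. -/
lemma norm_fderiv_mollify_le {U : Set (E s)} {f : E s → E n}
    (hf : LocallyIntegrableOn f U) {g : Fin s → E s → E n}
    (hw : ∀ j, HasWeakDeriv (Pi.single j 1) U f (g j)) {B : ℝ}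
    (hB0 : 0 ≤ B) (hB : ∀ j, ∀ᵐ x ∂volume.restrict U, ‖g j x‖ ≤ B)
    {K : Set (E s)} (hK : IsCompact K) (hKU : K ⊆ U) (φ : ContDiffBump (0 : E s)) {x : E s}
    (hx : Metric.closedBall x φ.rOut ⊆ K) :
    ∃ D : E s →L[ℝ] E n,
      HasFDerivAt (convolution (φ.normed volume) (K.indicator f) (ContinuousLinearMap.lsmul ℝ ℝ)
        volume) D x ∧ ‖D‖ ≤ s * B := by
  set ψ : E s → ℝ := φ.normed volume with hψ
  have hψs : ContDiff ℝ (⊤ : ℕ∞) ψ := φ.contDiff_normed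
  have hψ1 : ContDiff ℝ 1 ψ := φ.contDiff_normed
  have hψc : HasCompactSupport ψ := φ.hasCompactSupport_normed
  have hF : Integrable (K.indicator f) :=
    (integrable_indicator_iff hK.measurableSet).2 (hf.integrableOn_compact_subset hKU hK)
  have hder := hψc.hasFDerivAt_convolution_left (ContinuousLinearMap.lsmul ℝ ℝ) hψ1
    hF.locallyIntegrable x
  refine ⟨_, hder, ContinuousLinearMap.opNorm_le_bound _ (by positivity) fun v => ?_⟩
  set η : E s → ℝ := fun y => ψ (x - y) with hηdef
  have hη : ContDiff ℝ (⊤ : ℕ∞) η := hψs.comp (contDiff_const.sub contDiff_id)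
  have hηsupp : tsupport η ⊆ Metric.closedBall x φ.rOut := by
    refine closure_minimal (fun y hy => ?_) Metric.isClosed_closedBall
    have : x - y ∈ Function.support ψ := hy
    rw [hψ, φ.support_normed_eq, mem_ball_zero_iff] at this
    rw [Metric.mem_closedBall, dist_comm, dist_eq_norm]
    exact this.le
  have hηc : HasCompactSupport η :=
    (isCompact_closedBall x φ.rOut).of_isClosed_subset (isClosed_tsupport _) hηsupp
  have hηU : tsupport η ⊆ U := (hηsupp.trans hx).trans hKU
  have hη0 : ∀ y, 0 ≤ η y := fun y => φ.nonneg_normed _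
  have hηi : Integrable η := hη.continuous.integrable_of_hasCompactSupport hηc
  have hη1 : ∫ y, η y = 1 := by
    rw [hηdef, integral_sub_left_eq_self ψ volume x]
    exact φ.integral_normed
  have hηd : ∀ y w, fderiv ℝ η y w = - fderiv ℝ ψ (x - y) w := by
    intro y w
    have h1 := (hψs.differentiable (by simp) (x - y)).hasFDerivAt
    have h2 : HasFDerivAt (fun y => x - y) (-ContinuousLinearMap.id ℝ (E s)) y := by
      simpa using (hasFDerivAt_id y).const_sub x
    have := (h1.comp y h2).fderiv
    simp [hηdef, Function.comp_def] at this ⊢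
    rw [this]; simp
  have hcv : ConvolutionExistsAt (fderiv ℝ ψ) (K.indicator f) x
      ((ContinuousLinearMap.lsmul ℝ ℝ).precompL (E s)) volume :=
    (hψc.fderiv ℝ).convolutionExists_left _ (hψs.continuous_fderiv (by simp))
      hF.locallyIntegrable x
  have hval : convolution (fderiv ℝ ψ) (K.indicator f)
      ((ContinuousLinearMap.lsmul ℝ ℝ).precompL (E s)) volume x v
      = ∫ y in U, η y • ∑ j, v j • g j y := by
    have e1 : convolution (fderiv ℝ ψ) (K.indicator f)
        ((ContinuousLinearMap.lsmul ℝ ℝ).precompL (E s)) volume x v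
        = ∫ t, fderiv ℝ ψ t v • K.indicator f (x - t) := by
      rw [convolution_def, ContinuousLinearMap.integral_apply hcv]
      rfl
    have e2 : ∫ t, fderiv ℝ ψ t v • K.indicator f (x - t)
        = ∫ y, fderiv ℝ ψ (x - y) v • K.indicator f y := by
      rw [← integral_sub_left_eq_self _ volume x]
      simp
    have hts : tsupport (fun y => fderiv ℝ η y v) ⊆ tsupport η :=
      tsupport_fderiv_apply_subset ℝ v
    have e3 : ∫ y, fderiv ℝ ψ (x - y) v • K.indicator f y
        = - ∫ y in U, fderiv ℝ η y v • f y := by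
      rw [setIntegral_smul_of_tsupport (hts.trans hηU), ← integral_neg]
      refine integral_congr_ae (Filter.Eventually.of_forall fun y => ?_)
      simp only
      rw [hηd, neg_smul, neg_neg]
      by_cases hy : y ∈ K
      · rw [Set.indicator_of_mem hy]
      · have : fderiv ℝ η y v = 0 := image_eq_zero_of_notMem_tsupport
          (f := fun y => fderiv ℝ η y v) fun h => hy (hx (hηsupp (hts h)))
        rw [hηd, neg_eq_zero] at this
        rw [this, zero_smul, zero_smul]
    rw [e1, e2, e3]
    have e4 : ∀ y, fderiv ℝ η y v • f y = ∑ j, v j • (partialDeriv j η y • f y) := by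
      intro y
      rw [fderiv_eq_sum_partialDeriv, Finset.sum_smul]
      simp [mul_smul]
    have hpi : ∀ j, Integrable (fun y => partialDeriv j η y • f y) := fun j =>
      have hsj : tsupport (partialDeriv j η) ⊆ tsupport η := tsupport_fderiv_apply_subset ℝ _
      integrable_test_smul hf (contDiff_listDeriv [j] hη).continuous
        (hηc.of_isClosed_subset (isClosed_tsupport _) hsj) (hsj.trans hηU)
    have hgi : ∀ j, Integrable (fun y => η y • g j y) := fun j =>
      integrable_test_smul (hw j).locInt_deriv hη.continuous hηc hηU
    have e5 : ∀ y, η y • ∑ j, v j • g j y = ∑ j, v j • (η y • g j y) := by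
      intro y
      rw [Finset.smul_sum]
      exact Finset.sum_congr rfl fun j _ => smul_comm _ _ _
    simp only [e4, e5]
    have hpi' : ∀ j ∈ Finset.univ, Integrable (fun y => v j • partialDeriv j η y • f y)
        (volume.restrict U) := fun j _ => ((hpi j).smul (v j)).integrableOn
    have hgi' : ∀ j ∈ Finset.univ, Integrable (fun y => v j • η y • g j y)
        (volume.restrict U) := fun j _ => ((hgi j).smul (v j)).integrableOn
    rw [integral_finsetSum _ hpi', integral_finsetSum _ hgi', ← Finset.sum_neg_distrib]
    refine Finset.sum_congr rfl fun j _ => ?_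
    rw [integral_smul, integral_smul, ← smul_neg]
    have := (hw j).integral_eq η hη hηc hηU
    rw [multiDeriv_single j hη] at this
    rw [this]
    simp
  rw [hval]
  have hbound : ∀ᵐ y ∂volume.restrict U,
      ‖η y • ∑ j, v j • g j y‖ ≤ η y * (s * B * ‖v‖) := by
    filter_upwards [ae_all_iff.2 hB] with y hy
    rw [norm_smul, Real.norm_of_nonneg (hη0 y)]
    refine mul_le_mul_of_nonneg_left ?_ (hη0 y)
    calc ‖∑ j, v j • g j y‖ ≤ ∑ j : Fin s, ‖v‖ * B := by
          refine norm_sum_le_of_le _ fun j _ => ?_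
          rw [norm_smul]
          exact mul_le_mul (PiLp.norm_apply_le v j) (hy j) (norm_nonneg _) (norm_nonneg _)
      _ = s * B * ‖v‖ := by simp; ring
  calc _ ≤ ∫ y in U, η y * (s * B * ‖v‖) :=
        norm_integral_le_of_norm_le (hηi.mul_const _).integrableOn hbound
    _ ≤ ∫ y, η y * (s * B * ‖v‖) :=
        setIntegral_le_integral (hηi.mul_const _)
          (Filter.Eventually.of_forall fun y => mul_nonneg (hη0 y) (by positivity))
    _ = s * B * ‖v‖ := by rw [integral_mul_const, hη1, one_mul]

/-- A function with weak partial derivatives bounded by `B` is almost everywhere equal to a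
Lipschitz function on each bounded convex set well inside the domain. -/
lemma exists_lipschitzWith_ae_eq {U : Set (E s)} {f : E s → E n}
    (hf : LocallyIntegrableOn f U) {g : Fin s → E s → E n}
    (hw : ∀ j, HasWeakDeriv (Pi.single j 1) U f (g j)) {B : ℝ≥0}
    (hB : ∀ j, ∀ᵐ x ∂volume.restrict U, ‖g j x‖ ≤ B)
    {V : Set (E s)} (hV : Convex ℝ V) (hVo : IsOpen V) (hVb : Bornology.IsBounded V) {r : ℝ}
    (hr : 0 < r) (hVU : Metric.cthickening r V ⊆ U) :
    ∃ h : E s → E n, LipschitzWith (lipschitzExtensionConstant (E n) * (s * B)) h ∧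
      f =ᵐ[volume.restrict V] h := by
  set K := Metric.cthickening r V with hKdef
  have hK : IsCompact K := Metric.isCompact_of_isClosed_isBounded Metric.isClosed_cthickening
    hVb.cthickening
  have hF : Integrable (K.indicator f) :=
    (integrable_indicator_iff hK.measurableSet).2 (hf.integrableOn_compact_subset hVU hK)
  let φ : ℕ → ContDiffBump (0 : E s) := fun k =>
    ⟨r / (2 * (k + 1)), r / (k + 1), by positivity, by
      rw [div_lt_div_iff_of_pos_left hr (by positivity) (by positivity)]
      have : (0 : ℝ) < k + 1 := by positivity
      linarith⟩
  have hφ0 : Filter.Tendsto (fun k => (φ k).rOut) Filter.atTop (nhds 0) :=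
    tendsto_const_div_atTop_nhds_zero_nat r |>.comp (Filter.tendsto_add_atTop_nat 1) |>.congr
      fun k => by simp [φ]
  have hφr : ∀ k, (φ k).rOut ≤ r := fun k => by
    refine div_le_self hr.le ?_
    have : (0 : ℝ) ≤ k := by positivity
    linarith
  have hae := ContDiffBump.ae_convolution_tendsto_right_of_locallyIntegrable
    (μ := (volume : Measure (E s))) (K := 2) hφ0
    (Filter.Eventually.of_forall fun k => by
      simp only [φ]
      apply le_of_eq
      field_simp) hF.locallyIntegrable
  set A : Set (E s) := {x | x ∈ V ∧ Filter.Tendsto (fun k => convolution ((φ k).normed volume)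
    (K.indicator f) (ContinuousLinearMap.lsmul ℝ ℝ) volume x) Filter.atTop
      (nhds (K.indicator f x))} with hA
  have hVK : V ⊆ K := Metric.self_subset_cthickening V
  have hLip : LipschitzOnWith (s * B) f A := by
    refine LipschitzOnWith.of_dist_le_mul fun x hx y hy => ?_
    have hx' := hx.2
    have hy' := hy.2
    rw [Set.indicator_of_mem (hVK hx.1)] at hx'
    rw [Set.indicator_of_mem (hVK hy.1)] at hy'
    refine le_of_tendsto (hx'.dist hy') (Filter.Eventually.of_forall fun k => ?_)
    have hball : ∀ w ∈ V, Metric.closedBall w (φ k).rOut ⊆ K := fun w hw =>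
      (Metric.closedBall_subset_closedBall (hφr k)).trans
        (Metric.closedBall_subset_cthickening hw r)
    choose! D hD using fun w (hwV : w ∈ V) =>
      norm_fderiv_mollify_le hf hw B.coe_nonneg hB hK hVU (φ k) (hball w hwV)
    rw [dist_eq_norm, dist_eq_norm]
    have := hV.norm_image_sub_le_of_norm_hasFDerivWithin_le
      (fun w hwV => (hD w hwV).1.hasFDerivWithinAt) (fun w hwV => (hD w hwV).2) hy.1 hx.1
    simpa using this
  obtain ⟨h, hh, hfh⟩ := hLip.extend_finite_dimension
  refine ⟨h, hh, ?_⟩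
  rw [Filter.EventuallyEq, ae_restrict_iff' hVo.measurableSet]
  filter_upwards [hae] with x hx hxV using hfh ⟨hxV, hx⟩

/-- A function with bounded weak partial derivatives has a continuous representative. -/
lemma exists_continuousOn_ae_eq {U : Set (E s)} (hU : IsOpen U) {f : E s → E n}
    (hf : LocallyIntegrableOn f U) {g : Fin s → E s → E n}
    (hw : ∀ j, HasWeakDeriv (Pi.single j 1) U f (g j)) {B : ℝ≥0}
    (hB : ∀ j, ∀ᵐ x ∂volume.restrict U, ‖g j x‖ ≤ B) :
    ∃ h : E s → E n, ContinuousOn h U ∧ f =ᵐ[volume.restrict U] h := by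
  have hloc : ∀ x ∈ U, ∃ r > 0, ∃ h : E s → E n, Continuous h ∧
      f =ᵐ[volume.restrict (Metric.ball x r)] h := by
    intro x hx
    obtain ⟨r, hr, hrU⟩ := Metric.nhds_basis_closedBall.mem_iff.1 (hU.mem_nhds hx)
    obtain ⟨h, hh, hfh⟩ := exists_lipschitzWith_ae_eq hf hw hB (convex_ball x (r / 2))
      Metric.isOpen_ball Metric.isBounded_ball (half_pos hr) (by
        rw [cthickening_ball (half_pos hr).le (half_pos hr), add_halves]
        exact hrU)
    exact ⟨r / 2, half_pos hr, h, hh.continuous, hfh⟩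
  choose! r hr h hc hfh using hloc
  -- Two local representatives agree on the overlap of their balls, hence near each common point.
  have hagree : ∀ x ∈ U, ∀ y ∈ U, y ∈ Metric.ball x (r x) → h y y = h x y := by
    intro x hx y hy hyx
    have h1 : f =ᵐ[volume.restrict (Metric.ball y (r y) ∩ Metric.ball x (r x))] h x :=
      ae_restrict_of_ae_restrict_of_subset Set.inter_subset_right (hfh x hx)
    have h2 : f =ᵐ[volume.restrict (Metric.ball y (r y) ∩ Metric.ball x (r x))] h y :=
      ae_restrict_of_ae_restrict_of_subset Set.inter_subset_left (hfh y hy)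
    have hae : h y =ᵐ[volume.restrict (Metric.ball y (r y) ∩ Metric.ball x (r x))] h x :=
      h2.symm.trans h1
    exact Measure.eqOn_open_of_ae_eq hae (Metric.isOpen_ball.inter Metric.isOpen_ball)
      (hc y hy).continuousOn (hc x hx).continuousOn ⟨Metric.mem_ball_self (hr y hy), hyx⟩
  have heq : ∀ x ∈ U, ∀ y ∈ U ∩ Metric.ball x (r x), h y y = h x y :=
    fun x hx y hy => hagree x hx y hy.1 hy.2
  refine ⟨fun x => h x x, fun x hx => ?_, ?_⟩
  · refine ((hc x hx).continuousAt.congr ?_).continuousWithinAt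
    filter_upwards [hU.mem_nhds hx, Metric.ball_mem_nhds x (hr x hx)] with y hy hyx
    exact (heq x hx y ⟨hy, hyx⟩).symm
  · rw [Filter.EventuallyEq, ae_restrict_iff' hU.measurableSet]
    have hnull : volume {x | x ∈ U ∧ f x ≠ h x x} = 0 := by
      refine measure_null_of_locally_null _ fun x hx => ?_
      refine ⟨_, inter_mem_nhdsWithin _ (Metric.ball_mem_nhds x (hr x hx.1)), ?_⟩
      have := hfh x hx.1
      rw [Filter.EventuallyEq, ae_restrict_iff' measurableSet_ball] at this
      refine measure_mono_null (fun y hy => ?_) this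
      intro hy'
      exact hy.1.2 ((hy' hy.2).trans (heq x hx.1 y ⟨hy.1.1, hy.2⟩).symm)
    filter_upwards [measure_eq_zero_iff_ae_notMem.1 hnull] with x hx hxU
    by_contra hne
    exact hx ⟨hxU, hne⟩

/-- A continuous function whose weak partial derivatives are bounded by `B` is Lipschitz along
segments, with a constant proportional to `B`. -/
lemma norm_sub_le_of_segment_subset {U : Set (E s)} (hU : IsOpen U) {f : E s → E n}
    (hf : ContinuousOn f U) {g : Fin s → E s → E n}
    (hw : ∀ j, HasWeakDeriv (Pi.single j 1) U f (g j)) {B : ℝ≥0}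
    (hB : ∀ j, ∀ᵐ x ∂volume.restrict U, ‖g j x‖ ≤ B) {x y : E s} (hxy : segment ℝ x y ⊆ U) :
    ‖f y - f x‖ ≤ lipschitzExtensionConstant (E n) * (s * B) * ‖y - x‖ := by
  have hseg : IsCompact (segment ℝ x y) := by
    rw [segment_eq_image_lineMap]
    exact isCompact_Icc.image (AffineMap.lineMap_continuous)
  obtain ⟨r, hr, hrU⟩ := hseg.exists_cthickening_subset_open hU hxy
  set V := Metric.thickening (r / 2) (segment ℝ x y) with hVdef
  have hsV : segment ℝ x y ⊆ V := Metric.self_subset_thickening (half_pos hr) _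
  obtain ⟨h, hh, hfh⟩ := exists_lipschitzWith_ae_eq (hf.locallyIntegrableOn hU.measurableSet)
    hw hB ((convex_segment x y).thickening (r / 2)) Metric.isOpen_thickening
    hseg.isBounded.thickening (half_pos hr) (by
      refine (Metric.cthickening_thickening_subset (half_pos hr).le _ _).trans ?_
      simpa using hrU)
  have hVU : V ⊆ U := (Metric.thickening_subset_cthickening_of_le (by linarith) _).trans hrU
  have heq := Measure.eqOn_open_of_ae_eq hfh Metric.isOpen_thickening (hf.mono hVU)
    hh.continuous.continuousOn
  rw [heq (hsV (left_mem_segment ℝ x y)), heq (hsV (right_mem_segment ℝ x y)), ← dist_eq_norm,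
    ← dist_eq_norm]
  exact_mod_cast hh.dist_le_mul y x

/-- A continuous function with continuous weak partial derivatives is differentiable, with these
partial derivatives: the Lipschitz estimate applies to the difference with the affine
approximation. -/
lemma hasFDerivAt_of_continuousOn_weak {U : Set (E s)} (hU : IsOpen U) {f : E s → E n}
    (hf : ContinuousOn f U) {g : Fin s → E s → E n}
    (hw : ∀ j, HasWeakDeriv (Pi.single j 1) U f (g j)) (hg : ∀ j, ContinuousOn (g j) U)
    {x : E s} (hx : x ∈ U) :
    HasFDerivAt f (∑ j, (EuclideanSpace.proj j : E s →L[ℝ] ℝ).smulRight (g j x)) x := by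
  set D : E s →L[ℝ] E n := ∑ j, (EuclideanSpace.proj j : E s →L[ℝ] ℝ).smulRight (g j x) with hD
  have hDj : ∀ j, D (EuclideanSpace.single j 1) = g j x := by
    intro j
    simp [hD]
  rw [hasFDerivAt_iff_isLittleO, Asymptotics.isLittleO_iff]
  intro c hc
  set κ : ℝ := lipschitzExtensionConstant (E n) * s with hκ
  have hκ0 : 0 ≤ κ := by positivity
  have hc0 : 0 < c / (κ + 1) := by positivity
  set ε : ℝ≥0 := (c / (κ + 1)).toNNReal with hε
  have hεv : (ε : ℝ) = c / (κ + 1) := Real.coe_toNNReal _ hc0.le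
  have hεpos : (0 : ℝ) < ε := by rw [hεv]; exact hc0
  have hnear : ∀ᶠ y in nhds x, y ∈ U ∧ ∀ j, ‖g j y - g j x‖ ≤ ε := by
    refine (hU.eventually_mem hx).and (Filter.eventually_all.2 fun j => ?_)
    have := ((hg j).continuousAt (hU.mem_nhds hx)).eventually (Metric.closedBall_mem_nhds _ hεpos)
    filter_upwards [this] with y hy
    rwa [← dist_eq_norm]
  obtain ⟨r, hr, hball⟩ := Metric.eventually_nhds_iff_ball.1 hnear
  have hbU : Metric.ball x r ⊆ U := fun y hy => (hball y hy).1
  have hlin : ∀ j, HasWeakDeriv (Pi.single j 1) (Metric.ball x r) (fun y => D y)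
      (fun _ => g j x) := by
    intro j
    have h1 := hasWeakDeriv_of_contDiffOn (Metric.isOpen_ball (x := x) (ε := r)) (Pi.single j 1)
      (f := fun y => D y) D.contDiff.contDiffOn
    rw [multiList_single] at h1
    convert h1 using 1
    ext1 y
    simp [listDeriv_cons, hDj]
  filter_upwards [Metric.ball_mem_nhds x hr] with y hy
  have hest := norm_sub_le_of_segment_subset (Metric.isOpen_ball (x := x) (ε := r))
    (f := f - fun y => D y) ((hf.mono hbU).sub D.continuous.continuousOn)
    (fun j => ((hw j).mono hbU).sub (hlin j)) (B := ε)
    (fun j => (ae_restrict_iff' measurableSet_ball).2 (Filter.Eventually.of_forall fun y hy => by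
      simpa using (hball y hy).2 j))
    ((convex_ball x r).segment_subset (Metric.mem_ball_self hr) hy)
  have e : (f - fun y => D y) y - (f - fun y => D y) x = f y - f x - D (y - x) := by
    simp only [Pi.sub_apply, map_sub]; abel
  rw [e] at hest
  refine hest.trans (mul_le_mul_of_nonneg_right ?_ (norm_nonneg _))
  have : lipschitzExtensionConstant (E n) * (s * (ε : ℝ)) = κ * (c / (κ + 1)) := by
    rw [hεv, hκ]; ring
  rw [this, mul_div_assoc', div_le_iff₀ (by positivity)]
  nlinarith

end lipschitz

/-! ### Continuous functions in `W^{k+1,∞}` are of class `C^k` -/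

section regularity

variable {s n : ℕ}

lemma sum_add_single (a : Fin s → ℕ) (j : Fin s) :
    ∑ i, (a + Pi.single j 1 : Fin s → ℕ) i = ∑ i, a i + 1 := by
  simp [Finset.sum_add_distrib]

/-- A multilinear map on `ℝ^s` is controlled by its values on basis vectors. -/
lemma norm_multilinear_le_of_basis {F : Type*} [NormedAddCommGroup F] [NormedSpace ℝ F] {j : ℕ}
    (A : ContinuousMultilinearMap ℝ (fun _ : Fin j => E s) F) {B : ℝ} (hB0 : 0 ≤ B)
    (hB : ∀ t : Fin j → Fin s, ‖A fun i => EuclideanSpace.single (t i) 1‖ ≤ B) :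
    ‖A‖ ≤ (s : ℝ) ^ j * B := by
  refine ContinuousMultilinearMap.opNorm_le_bound (by positivity) fun v => ?_
  have hv : v = fun i => ∑ k, v i k • EuclideanSpace.single k (1 : ℝ) := by
    funext i
    ext l; simp [Finset.sum_apply, Pi.single_apply]
  conv_lhs => rw [hv]
  rw [ContinuousMultilinearMap.map_sum]
  calc _ ≤ ∑ t : Fin j → Fin s, (∏ i, ‖v i‖) * B := by
        refine norm_sum_le_of_le _ fun t _ => ?_
        rw [ContinuousMultilinearMap.map_smul_univ, norm_smul, norm_prod]
        exact mul_le_mul (Finset.prod_le_prod (fun _ _ => norm_nonneg _)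
          fun i _ => PiLp.norm_apply_le (v i) (t i)) (hB t) (norm_nonneg _)
          (Finset.prod_nonneg fun _ _ => norm_nonneg _)
    _ = (s : ℝ) ^ j * B * ∏ i, ‖v i‖ := by simp; ring

/-- Each weak derivative of order at most `k` of a function in `W^{k+1,∞}` has a continuous
representative, these representatives are classical derivatives of each other, and they are
Lipschitz along segments. -/
lemma exists_continuous_weak_derivatives {U : Set (E s)} (hU : IsOpen U) {f : E s → E n}
    (hf : ContinuousOn f U) {k : ℕ} {B : ℝ≥0}
    (hB : ∀ a : Fin s → ℕ, ∑ j, a j ≤ k + 1 → weakDerivNorm a ∞ U f ≤ B) :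
    ∃ h : (Fin s → ℕ) → E s → E n, Set.EqOn (h 0) f U ∧
      (∀ a, ∑ j, a j ≤ k → ContinuousOn (h a) U ∧ ∀ x ∈ U, ‖h a x‖ ≤ B) ∧
      (∀ a, ∑ j, a j + 1 ≤ k → ∀ x ∈ U, HasFDerivAt (h a)
        (∑ j, (EuclideanSpace.proj j : E s →L[ℝ] ℝ).smulRight (h (a + Pi.single j 1) x)) x) ∧
      ∀ a, ∑ j, a j ≤ k → ∀ x y, segment ℝ x y ⊆ U →
        ‖h a y - h a x‖ ≤ lipschitzExtensionConstant (E n) * (s * B) * ‖y - x‖ := by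
  have hex : ∀ a : Fin s → ℕ, ∑ j, a j ≤ k + 1 → ∃ g, HasWeakDeriv a U f g ∧
      ∀ᵐ x ∂volume.restrict U, ‖g x‖ ≤ B := by
    intro a ha
    have h1 : weakDerivNorm a ∞ U f < ∞ := (hB a ha).trans_lt ENNReal.coe_lt_top
    unfold weakDerivNorm at h1
    obtain ⟨g, hg⟩ := iInf_lt_iff.1 h1
    obtain ⟨hw, -⟩ := iInf_lt_iff.1 hg
    refine ⟨g, hw, ?_⟩
    have h2 := hB a ha
    rw [weakDerivNorm_eq hU hw, eLpNorm_exponent_top] at h2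
    filter_upwards [ae_le_eLpNormEssSup (f := g) (μ := volume.restrict U)] with x hx
    have := hx.trans h2
    rw [enorm_eq_nnnorm] at this
    exact_mod_cast this
  choose! g hgw hgB using hex
  have hpart : ∀ a : Fin s → ℕ, ∑ j, a j ≤ k → ∀ j,
      HasWeakDeriv (Pi.single j 1) U (g a) (g (a + Pi.single j 1)) := fun a ha j =>
    (hgw a (by omega)).partial (hgw _ (by rw [sum_add_single]; omega))
  have hpB : ∀ a : Fin s → ℕ, ∑ j, a j ≤ k → ∀ j, ∀ᵐ x ∂volume.restrict U,
      ‖g (a + Pi.single j 1) x‖ ≤ B := fun a ha j => hgB _ (by rw [sum_add_single]; omega)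
  have hrep : ∀ a : Fin s → ℕ, ∑ j, a j ≤ k → ∃ h : E s → E n, ContinuousOn h U ∧
      g a =ᵐ[volume.restrict U] h := fun a ha =>
    exists_continuousOn_ae_eq hU (hgw a (by omega)).locInt_deriv (hpart a ha) (hpB a ha)
  choose! h hc hae using hrep
  refine ⟨h, ?_, fun a ha => ⟨hc a ha, ?_⟩, fun a ha x hx => ?_, fun a ha x y hxy => ?_⟩
  · have h0 : ∑ j, (0 : Fin s → ℕ) j ≤ k := by simp
    have hf0 : HasWeakDeriv 0 U f f := by
      have hff : ContDiffOn ℝ (∑ j, (0 : Fin s → ℕ) j : ℕ) f U := by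
        simpa [contDiffOn_zero] using hf
      have := hasWeakDeriv_of_contDiffOn hU 0 hff
      rwa [multiList_zero] at this
    exact Measure.eqOn_open_of_ae_eq
      ((hae 0 h0).symm.trans ((hgw 0 (by omega)).ae_eq hU hf0)) hU (hc 0 h0) hf
  · -- An almost everywhere bound of a continuous function on an open set holds everywhere.
    have hmin : Set.EqOn (fun x => max ‖h a x‖ B) (fun _ => (B : ℝ)) U := by
      refine Measure.eqOn_open_of_ae_eq (μ := (volume : Measure (E s))) ?_ hU
        ((hc a ha).norm.sup continuousOn_const) continuousOn_const
      filter_upwards [hae a ha, hgB a (by omega)] with x hx hx'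
      rw [hx] at hx'
      exact max_eq_right hx'
    intro x hx
    exact max_eq_right_iff.1 (hmin hx)
  · have hle : ∀ j, ∑ i, (a + Pi.single j 1 : Fin s → ℕ) i ≤ k := fun j => by
      rw [sum_add_single]; omega
    exact hasFDerivAt_of_continuousOn_weak hU (hc a (by omega)) (fun j =>
      (hpart a (by omega) j).congr (hae a (by omega)) (hae _ (hle j))) (fun j => hc _ (hle j)) hx
  · exact norm_sub_le_of_segment_subset hU (hc a ha)
      (fun j => (hpart a ha j).congr (hae a ha) (ae_eq_refl _)) (hpB a ha) hxy

/-- A continuous function in `W^{k+1,∞}` is of class `C^k`, with derivatives controlled by the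
Sobolev norm, and its first derivative is Lipschitz along segments. -/
theorem contDiffOn_of_weakDerivNorm_le {U : Set (E s)} (hU : IsOpen U) {f : E s → E n}
    (hf : ContinuousOn f U) {k : ℕ} {B : ℝ≥0}
    (hB : ∀ a : Fin s → ℕ, ∑ j, a j ≤ k + 1 → weakDerivNorm a ∞ U f ≤ B) :
    ContDiffOn ℝ k f U ∧
      (∀ j ≤ k, ∀ x ∈ U, ‖iteratedFDeriv ℝ j f x‖ ≤ (s : ℝ) ^ j * B) ∧
      (1 ≤ k → ∀ x y, segment ℝ x y ⊆ U → ‖fderiv ℝ f y - fderiv ℝ f x‖ ≤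
        s * (lipschitzExtensionConstant (E n) * (s * B)) * ‖y - x‖) := by
  obtain ⟨h, h0, hc, hd, hL⟩ := exists_continuous_weak_derivatives hU hf hB
  have hcd : ∀ (i : ℕ) (a : Fin s → ℕ), ∑ j, a j + i ≤ k → ContDiffOn ℝ i (h a) U := by
    intro i
    induction i with
    | zero => intro a ha; simpa [contDiffOn_zero] using (hc a (by omega)).1
    | succ i ih =>
      intro a ha
      have hda := hd a (by omega)
      push_cast
      rw [contDiffOn_succ_iff_fderiv_of_isOpen hU]
      refine ⟨fun x hx => (hda x hx).differentiableAt.differentiableWithinAt, by simp, ?_⟩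
      refine ContDiffOn.congr ?_ fun x hx => (hda x hx).fderiv
      refine ContDiffOn.sum fun j _ => ?_
      exact contDiffOn_const.smulRight (ih _ (by rw [sum_add_single]; omega))
  have hfk : ContDiffOn ℝ k f U := (hcd k 0 (by simp)).congr fun x hx => (h0 hx).symm
  have hcount : ∀ l : List (Fin s), ∑ i, l.count i = l.length := fun l => by
    simpa using Multiset.sum_count_eq_card (s := Finset.univ) (m := (l : Multiset (Fin s)))
      (by simp)
  have hlist : ∀ l : List (Fin s), l.length ≤ k → ∀ x ∈ U,
      listDeriv l f x = h (fun j => l.count j) x := by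
    intro l
    induction l with
    | nil => intro _ x hx; exact (h0 hx).symm
    | cons j l ih =>
      intro hl x hx
      rw [List.length_cons] at hl
      have heq : listDeriv l f =ᶠ[nhds x] h (fun j => l.count j) := by
        filter_upwards [hU.mem_nhds hx] with y hy using ih (by omega) y hy
      rw [listDeriv_cons]
      simp only
      rw [heq.fderiv_eq, (hd _ (by rw [hcount]; omega) x hx).fderiv]
      have : (fun i => (j :: l).count i) = (fun i => l.count i) + Pi.single j 1 := by
        funext i
        rw [List.count_cons, Pi.add_apply, Pi.single_apply]
        by_cases hij : i = j
        · simp [hij]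
        · simp [hij, Ne.symm hij]
      rw [this]
      simp
  refine ⟨hfk, fun j hj x hx => ?_, fun hk x y hxy => ?_⟩
  · refine norm_multilinear_le_of_basis _ B.coe_nonneg fun t => ?_
    have hlen : (List.ofFn t).length = j := by simp
    have e := listDeriv_eq_iteratedFDeriv_of_length hU (List.ofFn t) hlen
      (hfk.of_le (by exact_mod_cast hj)) hx
    have e2 : (fun i => EuclideanSpace.single ((List.ofFn t).get (Fin.cast hlen.symm i)) (1 : ℝ)) =
        fun i => EuclideanSpace.single (t i) 1 := by
      funext i; simp
    rw [← e2, ← e, hlist _ (by rw [hlen]; exact hj) x hx]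
    exact (hc _ (by rw [hcount, hlen]; exact hj)).2 x hx
  · have hfd : ∀ z ∈ U, fderiv ℝ f z = ∑ j, (EuclideanSpace.proj j : E s →L[ℝ] ℝ).smulRight
        (h (0 + Pi.single j 1) z) := by
      intro z hz
      have heq : f =ᶠ[nhds z] h 0 := by
        filter_upwards [hU.mem_nhds hz] with w hw using (h0 hw).symm
      rw [heq.fderiv_eq, (hd 0 (by simpa using hk) z hz).fderiv]
    rw [hfd y (hxy (right_mem_segment ℝ x y)), hfd x (hxy (left_mem_segment ℝ x y)),
      ← Finset.sum_sub_distrib]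
    calc _ ≤ ∑ j : Fin s, lipschitzExtensionConstant (E n) * (s * B) * ‖y - x‖ := by
          refine norm_sum_le_of_le _ fun j _ => ?_
          refine le_trans ?_ (hL (0 + Pi.single j 1)
            (by rw [sum_add_single]; simpa using hk) x y hxy)
          refine ContinuousLinearMap.opNorm_le_bound _ (norm_nonneg _) fun v => ?_
          simp only [sub_apply, ContinuousLinearMap.smulRight_apply,
            ← smul_sub, norm_smul, PiLp.proj_apply]
          rw [mul_comm]
          exact mul_le_mul_of_nonneg_left (PiLp.norm_apply_le v j) (norm_nonneg _)
      _ = _ := by simp; ring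

end regularity

/-! ### The closest-point projection -/

section projection

open Topology

variable {n : ℕ} {M U : Set (E n)} {P : E n → E n}

lemma IsClosestPointProjection.mem (h : IsClosestPointProjection M U P) {q : E n} (hq : q ∈ U) :
    P q ∈ M ∧ ∀ r ∈ M, ‖P q - q‖ ≤ ‖r - q‖ := by
  have : P q ∈ ({P q} : Set (E n)) := rfl
  rw [← h q hq] at this
  exact this

lemma IsClosestPointProjection.eq (h : IsClosestPointProjection M U P) {q r : E n} (hq : q ∈ U)
    (hr : r ∈ M) (hmin : ∀ r' ∈ M, ‖r - q‖ ≤ ‖r' - q‖) : r = P q := by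
  have : r ∈ {r | r ∈ M ∧ ∀ r' ∈ M, ‖r - q‖ ≤ ‖r' - q‖} := ⟨hr, hmin⟩
  rw [h q hq] at this
  exact this

lemma IsClosestPointProjection.fixed (h : IsClosestPointProjection M U P) {y : E n} (hy : y ∈ M)
    (hyU : y ∈ U) : P y = y :=
  (h.eq hyU hy fun r' _ => by simp).symm

/-- A unique closest-point projection onto a closed set is continuous: cluster points of closest
points are closest points. -/
lemma IsClosestPointProjection.continuousOn (hM : IsClosed M)
    (h : IsClosestPointProjection M U P) : ContinuousOn P U := by
  intro q hq
  have hK : IsCompact (Metric.closedBall q (‖P q - q‖ + 2) ∩ M) :=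
    (isCompact_closedBall _ _).inter_right hM
  have hnear : ∀ ε > 0, ∀ᶠ q' in 𝓝[U] q, q' ∈ U ∧ ‖q' - q‖ < ε := fun ε hε => by
    filter_upwards [self_mem_nhdsWithin, mem_nhdsWithin_of_mem_nhds (Metric.ball_mem_nhds q hε)]
      with q' h1 h2
    exact ⟨h1, by rwa [← dist_eq_norm]⟩
  refine hK.tendsto_nhds_of_unique_mapClusterPt ?_ fun r hr hcl => ?_
  · filter_upwards [hnear 1 one_pos] with q' hq'
    refine ⟨?_, (h.mem hq'.1).1⟩
    have h1 := (h.mem hq'.1).2 _ (h.mem hq).1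
    have h2 : ‖P q' - q‖ ≤ ‖P q' - q'‖ + ‖q' - q‖ := norm_sub_le_norm_sub_add_norm_sub _ _ _
    have h3 : ‖P q - q'‖ ≤ ‖P q - q‖ + ‖q - q'‖ := norm_sub_le_norm_sub_add_norm_sub _ _ _
    rw [norm_sub_rev q q'] at h3
    rw [Metric.mem_closedBall, dist_eq_norm]
    linarith [hq'.2]
  · refine h.eq hq hr.2 fun r' hr' => ?_
    refine le_of_forall_pos_le_add fun ε hε => ?_
    have hfr : ∃ᶠ q' in 𝓝[U] q, P q' ∈ Metric.ball r (ε / 3) :=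
      hcl.frequently (Metric.ball_mem_nhds r (by positivity))
    obtain ⟨q', hPq, hqU, hqq⟩ := (hfr.and_eventually (hnear (ε / 3) (by positivity))).exists
    rw [Metric.mem_ball, dist_eq_norm] at hPq
    have h1 := (h.mem hqU).2 r' hr'
    have h2 : ‖r - q‖ ≤ ‖r - P q'‖ + ‖P q' - q‖ := norm_sub_le_norm_sub_add_norm_sub _ _ _
    have h3 : ‖P q' - q‖ ≤ ‖P q' - q'‖ + ‖q' - q‖ := norm_sub_le_norm_sub_add_norm_sub _ _ _
    have h4 : ‖r' - q'‖ ≤ ‖r' - q‖ + ‖q - q'‖ := norm_sub_le_norm_sub_add_norm_sub _ _ _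
    rw [norm_sub_rev q q'] at h4
    rw [norm_sub_rev] at hPq
    linarith

/-- A closest-point projection is a monotone operator. -/
lemma IsClosestPointProjection.inner_nonneg (h : IsClosestPointProjection M U P) {q q' : E n}
    (hq : q ∈ U) (hq' : q' ∈ U) : 0 ≤ inner ℝ (P q - P q') (q - q') := by
  have h1 := pow_le_pow_left₀ (norm_nonneg _) ((h.mem hq).2 _ (h.mem hq').1) 2
  have h2 := pow_le_pow_left₀ (norm_nonneg _) ((h.mem hq').2 _ (h.mem hq).1) 2
  rw [norm_sub_sq_real, norm_sub_sq_real] at h1 h2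
  simp only [inner_sub_left, inner_sub_right]
  linarith

/-- An idempotent linear map with nonnegative quadratic form is an orthogonal projection, so its
norm is at most one. -/
lemma norm_apply_le_of_idempotent_of_nonneg {A : E n →L[ℝ] E n} (hA : ∀ v, A (A v) = A v)
    (hpos : ∀ v, 0 ≤ inner ℝ (A v) v) (v : E n) : ‖A v‖ ≤ ‖v‖ := by
  have horth : inner ℝ (A v) (v - A v) = 0 := by
    by_contra hc
    set c : ℝ := inner ℝ (A v) (v - A v) with hcdef
    -- Otherwise the quadratic form is affine and non-constant along `A v + t (v - A v)`.
    have := hpos (A v + (-(‖A v‖ ^ 2 + 1) / c) • (v - A v))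
    rw [map_add, map_smul, map_sub, hA, sub_self, smul_zero, add_zero, inner_add_right,
      real_inner_self_eq_norm_sq, inner_smul_right, ← hcdef, div_mul_cancel₀ _ hc] at this
    linarith
  have hsq : ‖v‖ ^ 2 = ‖A v‖ ^ 2 + ‖v - A v‖ ^ 2 := by
    have := norm_add_sq_real (A v) (v - A v)
    rw [horth] at this
    simpa using this
  exact le_of_sq_le_sq (by nlinarith [sq_nonneg ‖v - A v‖]) (norm_nonneg _)

/-- On `M` the derivative of the closest-point projection is an orthogonal projection. -/
lemma IsClosestPointProjection.norm_fderiv_apply_le (hU : IsOpen U) (hMU : M ⊆ U)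
    (h : IsClosestPointProjection M U P) {y : E n} (hy : y ∈ M) (hd : DifferentiableAt ℝ P y)
    (v : E n) : ‖fderiv ℝ P y v‖ ≤ ‖v‖ := by
  have hfix := h.fixed hy (hMU hy)
  refine norm_apply_le_of_idempotent_of_nonneg (fun v => ?_) (fun v => ?_) v
  · have heq : P ∘ P =ᶠ[𝓝 y] P := by
      filter_upwards [hU.mem_nhds (hMU hy)] with q hq
      exact h.fixed (h.mem hq).1 (hMU (h.mem hq).1)
    have h1 : HasFDerivAt (P ∘ P) ((fderiv ℝ P y).comp (fderiv ℝ P y)) y := by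
      refine HasFDerivAt.comp y ?_ hd.hasFDerivAt
      rw [hfix]
      exact hd.hasFDerivAt
    have h2 := h1.unique (hd.hasFDerivAt.congr_of_eventuallyEq heq)
    exact congrArg (fun A : E n →L[ℝ] E n => A v) h2
  · have hline : HasDerivAt (fun t : ℝ => P (y + t • v)) (fderiv ℝ P y v) 0 :=
      hd.hasFDerivAt.hasLineDerivAt v
    have ht := (hline.tendsto_slope_zero).inner (tendsto_const_nhds (x := v)) (𝕜 := ℝ)
    have hUev : ∀ᶠ t : ℝ in 𝓝[≠] 0, y + t • v ∈ U := by
      have hcont : ContinuousAt (fun t : ℝ => y + t • v) 0 := by fun_prop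
      exact nhdsWithin_le_nhds (hcont.eventually (hU.mem_nhds (by simpa using hMU hy)))
    refine ge_of_tendsto ht ?_
    filter_upwards [hUev, self_mem_nhdsWithin] with t htU ht0
    have hm := h.inner_nonneg htU (hMU hy)
    rw [add_sub_cancel_left, inner_smul_right] at hm
    simp only [zero_add, zero_smul, add_zero]
    rw [real_inner_smul_left]
    have ht0' : t ≠ 0 := ht0
    have e : t⁻¹ * inner ℝ (P (y + t • v) - P y) v =
        (t⁻¹) ^ 2 * (t * inner ℝ (P (y + t • v) - P y) v) := by
      field_simp
    rw [e]
    positivity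

/-- The segment from a point of the tubular neighbourhood to its projection stays inside. -/
lemma IsClosestPointProjection.segment_subset {δ : ℝ}
    (h : IsClosestPointProjection M (Metric.thickening δ M) P) {q : E n}
    (hq : q ∈ Metric.thickening δ M) : segment ℝ (P q) q ⊆ Metric.thickening δ M := by
  intro w hw
  obtain ⟨r, hr, hqr⟩ := Metric.mem_thickening_iff.1 hq
  have h1 := (h.mem hq).2 r hr
  refine Metric.mem_thickening_iff.2 ⟨P q, (h.mem hq).1, ?_⟩
  rw [dist_eq_norm] at hqr ⊢
  have h2 : ‖w - P q‖ ≤ ‖q - P q‖ := by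
    have hb := (convex_closedBall (P q) ‖q - P q‖).segment_subset
      (Metric.mem_closedBall_self (norm_nonneg _))
      (by rw [Metric.mem_closedBall, dist_eq_norm] : q ∈ Metric.closedBall (P q) ‖q - P q‖) hw
    rwa [Metric.mem_closedBall, dist_eq_norm] at hb
  rw [norm_sub_rev q] at h2
  rw [norm_sub_rev] at hqr
  linarith

/-- Points at geodesic distance at most `ρ` have Euclidean distance at most `ρ`. -/
lemma norm_sub_le_of_mem_geodesicBall {z y : E n} {ρ : ℝ≥0} (hy : y ∈ geodesicBall M z ρ) :
    ‖y - z‖ ≤ ρ := by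
  have h1 : ‖y - z‖ₑ ≤ geodesicDist M z y := by
    refine le_iInf₂ fun γ hγ => ?_
    have := enorm_sub_le_lintegral_derivWithin_Icc_of_contDiffOn_Icc hγ.1 zero_le_one
    rw [hγ.2.2.1, hγ.2.2.2] at this
    refine this.trans_eq ?_
    rw [← restrict_Ioo_eq_restrict_Icc]
    refine setLIntegral_congr_fun measurableSet_Ioo fun t ht => ?_
    rw [derivWithin_of_mem_nhds (Icc_mem_nhds ht.1 ht.2)]
  have h2 := h1.trans hy.2
  rw [enorm_eq_nnnorm] at h2
  exact_mod_cast h2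

end projection

/-! ### The nonlinear part of the higher-order chain rule -/

/-- In Faà di Bruno's formula all terms except the one containing the first derivative of `g` are at
least quadratic in the derivatives of `f`. Subtracting the linear part of `g` at `f x` removes that
one term. -/
lemma norm_iteratedFDeriv_comp_sub_le {X Y Z : Type*} [NormedAddCommGroup X] [NormedSpace ℝ X]
    [NormedAddCommGroup Y] [NormedSpace ℝ Y] [NormedAddCommGroup Z] [NormedSpace ℝ Z]
    {g : Y → Z} {f : X → Y} {x : X} {m : ℕ} (hm : 1 ≤ m) (hg : ContDiffAt ℝ m g (f x))
    (hf : ContDiffAt ℝ m f x) {a B : ℝ} (ha : 0 ≤ a) (hB0 : 0 ≤ B)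
    (hB : ∀ j ≤ m, ‖iteratedFDeriv ℝ j g (f x)‖ ≤ B)
    (hD : ∀ i, 1 ≤ i → i ≤ m → ‖iteratedFDeriv ℝ i f x‖ ≤ a) :
    ‖iteratedFDeriv ℝ m (g ∘ f) x -
        (fderiv ℝ g (f x)).compContinuousMultilinearMap (iteratedFDeriv ℝ m f x)‖ ≤
      Fintype.card (OrderedFinpartition m) * (B * (a * max a (a ^ m))) := by
  set A := fderiv ℝ g (f x) with hA
  set h : Y → Z := g - A with hh
  have hAc : ∀ k : WithTop ℕ∞, ContDiff ℝ k (A : Y → Z) := fun k => A.contDiff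
  have hhc : ContDiffAt ℝ m h (f x) := hg.sub (hAc m).contDiffAt
  have hm1 : (1 : WithTop ℕ∞) ≤ m := by exact_mod_cast hm
  have e1 : iteratedFDeriv ℝ m (h ∘ f) x = iteratedFDeriv ℝ m (g ∘ f) x -
      A.compContinuousMultilinearMap (iteratedFDeriv ℝ m f x) := by
    rw [← A.iteratedFDeriv_comp_left hf le_rfl]
    exact iteratedFDeriv_sub_apply (hg.comp x hf) ((hAc m).contDiffAt.comp x hf)
  rw [← e1, iteratedFDeriv_comp hhc hf le_rfl]
  have hpow : ∀ k, 1 ≤ k → k ≤ m → a ^ k ≤ max a (a ^ m) := by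
    intro k hk hkm
    rcases le_total a 1 with h1 | h1
    · exact le_max_of_le_left (by simpa using pow_le_pow_of_le_one ha h1 hk)
    · exact le_max_of_le_right (pow_le_pow_right₀ h1 hkm)
  have hterm : ∀ c : OrderedFinpartition m,
      ‖(ftaylorSeries ℝ h (f x)).compAlongOrderedFinpartition (ftaylorSeries ℝ f x) c‖ ≤
        B * (a * max a (a ^ m)) := by
    intro c
    have hlen : 1 ≤ c.length := c.length_pos hm
    have hlen' := c.length_le
    have hprod : ∏ i, ‖iteratedFDeriv ℝ (c.partSize i) f x‖ ≤ a ^ c.length := by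
      calc _ ≤ ∏ _i : Fin c.length, a := Finset.prod_le_prod (fun _ _ => norm_nonneg _)
            fun i _ => hD _ (c.partSize_pos i) (c.partSize_le i)
        _ = a ^ c.length := by simp
    refine (c.norm_compAlongOrderedFinpartition_le _ _).trans ?_
    change ‖iteratedFDeriv ℝ c.length h (f x)‖ * ∏ i, ‖iteratedFDeriv ℝ (c.partSize i) f x‖ ≤ _
    have hmax : 0 ≤ max a (a ^ m) := le_max_of_le_left ha
    rcases hlen.eq_or_lt with hl | hl
    · have hz : ‖iteratedFDeriv ℝ c.length h (f x)‖ = 0 := by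
        rw [← hl, ← zero_add 1, ← norm_iteratedFDeriv_fderiv, norm_iteratedFDeriv_zero]
        have hgd : DifferentiableAt ℝ g (f x) := hg.differentiableAt (by
          intro h0; rw [h0] at hm1; simp at hm1)
        rw [hh, fderiv_sub hgd A.differentiableAt, A.fderiv]
        simp [hA]
      rw [hz, zero_mul]
      positivity
    · have hz : ‖iteratedFDeriv ℝ c.length h (f x)‖ ≤ B := by
        have hle : (c.length : WithTop ℕ∞) ≤ m := by exact_mod_cast hlen'
        have hA0 : iteratedFDeriv ℝ c.length (A : Y → Z) (f x) = 0 := by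
          obtain ⟨k, hk⟩ : ∃ k, c.length = k + 1 := ⟨c.length - 1, by omega⟩
          have hk0 : k ≠ 0 := by omega
          rw [hk, ← norm_eq_zero, ← norm_iteratedFDeriv_fderiv]
          have : fderiv ℝ (A : Y → Z) = fun _ => A := by ext1 y; exact A.fderiv
          rw [this, iteratedFDeriv_const_of_ne hk0]
          simp
        rw [hh, iteratedFDeriv_sub_apply (hg.of_le hle) (hAc _).contDiffAt, hA0, sub_zero]
        exact hB _ hlen'
      obtain ⟨k, hk⟩ : ∃ k, c.length = k + 1 := ⟨c.length - 1, by omega⟩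
      have hak : a ^ c.length ≤ a * max a (a ^ m) := by
        rw [hk, pow_succ']
        exact mul_le_mul_of_nonneg_left (hpow k (by omega) (by omega)) ha
      exact mul_le_mul hz (hprod.trans hak)
        (Finset.prod_nonneg fun _ _ => norm_nonneg _) hB0
  calc _ ≤ ∑ _c : OrderedFinpartition m, B * (a * max a (a ^ m)) :=
        norm_sum_le_of_le _ fun c _ => hterm c
    _ = _ := by simp

/-! ### Estimates for interpolating polynomials -/

section interpolation

variable {s n N : ℕ}

lemma contDiff_polyEval (q : MvPolynomial (Fin s) ℝ) {k : WithTop ℕ∞} :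
    ContDiff ℝ k (polyEval q) := by
  unfold polyEval
  induction q using MvPolynomial.induction_on with
  | C a => simpa using contDiff_const
  | add p q hp hq => simpa using hp.add hq
  | mul_X p j hp =>
    simp only [map_mul, MvPolynomial.eval_X]
    exact hp.mul (EuclideanSpace.proj j : E s →L[ℝ] ℝ).contDiff

lemma contDiff_euclInterp (φ : Fin N → MvPolynomial (Fin s) ℝ) (c : Fin N → E n)
    {k : WithTop ℕ∞} : ContDiff ℝ k (euclInterp φ c) :=
  ContDiff.sum fun i _ => (contDiff_polyEval (φ i)).smul contDiff_const

lemma fderiv_euclInterp (φ : Fin N → MvPolynomial (Fin s) ℝ) (c : Fin N → E n) (x v : E s) :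
    fderiv ℝ (euclInterp φ c) x v = ∑ i, fderiv ℝ (polyEval (φ i)) x v • c i := by
  have hd : ∀ i, HasFDerivAt (fun x => polyEval (φ i) x • c i)
      ((fderiv ℝ (polyEval (φ i)) x).smulRight (c i)) x := fun i =>
    (((contDiff_polyEval (φ i) (k := 1)).differentiable (by simp) x).hasFDerivAt).smul_const (c i)
  have := (HasFDerivAt.fun_sum fun i (_ : i ∈ Finset.univ) => hd i).fderiv
  unfold euclInterp
  rw [this]
  simp

lemma euclInterp_sub (φ : Fin N → MvPolynomial (Fin s) ℝ) (c c' : Fin N → E n) :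
    euclInterp φ (c - c') = euclInterp φ c - euclInterp φ c' := by
  ext1 x
  simp [euclInterp, smul_sub]

/-- A Lagrange basis is a partition of unity. -/
lemma IsLagrangeBasis.sum_polyEval {T : Set (E s)} {r : ℕ} {ξ : Fin N → E s}
    {φ : Fin N → MvPolynomial (Fin s) ℝ} (h : IsLagrangeBasis T r ξ φ) (x : E s) :
    ∑ i, polyEval (φ i) x = 1 := by
  have h1 := congrArg (fun q => polyEval q x) (h.reproduces 1 (by simp))
  simpa [polyEval] using h1

lemma IsLagrangeBasis.euclInterp_const {T : Set (E s)} {r : ℕ} {ξ : Fin N → E s}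
    {φ : Fin N → MvPolynomial (Fin s) ℝ} (h : IsLagrangeBasis T r ξ φ) (z : E n) :
    euclInterp φ (fun _ => z) = fun _ => z := by
  ext1 x
  rw [euclInterp, ← Finset.sum_smul, h.sum_polyEval, one_smul]

/-- All derivatives up to order `m` of the interpolating function are controlled by the nodal
values. -/
lemma exists_norm_iteratedFDeriv_euclInterp_le {T : Set (E s)} (hT : Bornology.IsBounded T)
    (φ : Fin N → MvPolynomial (Fin s) ℝ) (m : ℕ) :
    ∃ K : ℝ≥0, ∀ (c : Fin N → E n), ∀ x ∈ T, ∀ i ≤ m,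
      ‖iteratedFDeriv ℝ i (euclInterp φ c) x‖ ≤ K * ‖c‖ := by
  have hcont : Continuous fun x => ∑ i ∈ Finset.range (m + 1), ∑ k,
      ‖iteratedFDeriv ℝ i (polyEval (φ k)) x‖ :=
    continuous_finsetSum _ fun i _ => continuous_finsetSum _ fun k _ =>
      ((contDiff_polyEval (φ k) (k := i)).continuous_iteratedFDeriv le_rfl).norm
  obtain ⟨K, hK⟩ := hT.isCompact_closure.bddAbove_image hcont.continuousOn
  refine ⟨K.toNNReal, fun c x hx i hi => ?_⟩
  have hKx := hK (Set.mem_image_of_mem _ (subset_closure hx))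
  have hsum : ∑ k, ‖iteratedFDeriv ℝ i (polyEval (φ k)) x‖ ≤ K :=
    (Finset.single_le_sum (f := fun i => ∑ k, ‖iteratedFDeriv ℝ i (polyEval (φ k)) x‖)
      (fun _ _ => Finset.sum_nonneg fun _ _ => norm_nonneg _)
      (Finset.mem_range.2 (Nat.lt_succ_of_le hi))).trans hKx
  have hterm : ∀ k, ‖iteratedFDeriv ℝ i (fun x => polyEval (φ k) x • c k) x‖ ≤
      ‖iteratedFDeriv ℝ i (polyEval (φ k)) x‖ * ‖c‖ := by
    intro k
    have h1 := ((ContinuousLinearMap.toSpanSingleton ℝ (c k))).norm_iteratedFDeriv_comp_left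
      (contDiff_polyEval (φ k) (k := i)).contDiffAt (n := i) (x := x) le_rfl
    rw [ContinuousLinearMap.norm_toSpanSingleton, mul_comm] at h1
    exact h1.trans (mul_le_mul_of_nonneg_left (norm_le_pi_norm c k) (norm_nonneg _))
  have hs : iteratedFDeriv ℝ i (euclInterp φ c) x =
      ∑ k, iteratedFDeriv ℝ i (fun x => polyEval (φ k) x • c k) x := by
    unfold euclInterp
    exact iteratedFDeriv_fun_sum_apply fun k _ =>
      ((contDiff_polyEval (φ k)).smul contDiff_const).contDiffAt
  calc ‖iteratedFDeriv ℝ i (euclInterp φ c) x‖ ≤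
        ∑ k, ‖iteratedFDeriv ℝ i (polyEval (φ k)) x‖ * ‖c‖ := by
        rw [hs]
        exact norm_sum_le_of_le _ fun k _ => hterm k
    _ = (∑ k, ‖iteratedFDeriv ℝ i (polyEval (φ k)) x‖) * ‖c‖ := by rw [Finset.sum_mul]
    _ ≤ K.toNNReal * ‖c‖ := by
        refine mul_le_mul_of_nonneg_right (hsum.trans ?_) (norm_nonneg _)
        exact Real.le_coe_toNNReal K

/-- A linear map on a finite-dimensional space has preimages of controlled size. -/
lemma exists_bounded_preimage {W Y : Type*} [NormedAddCommGroup W] [NormedSpace ℝ W]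
    [FiniteDimensional ℝ W] [NormedAddCommGroup Y] [NormedSpace ℝ Y] (f : W →ₗ[ℝ] Y) :
    ∃ C : ℝ≥0, ∀ w, ∃ w', f w' = f w ∧ ‖w'‖ ≤ C * ‖f w‖ := by
  obtain ⟨g, hg⟩ := f.rangeRestrict.exists_rightInverse_of_surjective f.range_rangeRestrict
  refine ⟨‖LinearMap.toContinuousLinearMap g‖₊, fun w => ⟨g (f.rangeRestrict w), ?_, ?_⟩⟩
  · have := LinearMap.congr_fun hg (f.rangeRestrict w)
    exact congrArg Subtype.val this
  · exact (LinearMap.toContinuousLinearMap g).le_opNorm (f.rangeRestrict w)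

end interpolation

/-! ### Sums over multi-indices -/

section sums

variable {ι : Type*} {A : Finset ι} {p : ℝ≥0∞}

/-- The `ℓ^p`-norm of a finite family in `[0, ∞]`. -/
def lpSum (A : Finset ι) (p : ℝ≥0∞) (X : ι → ℝ≥0∞) : ℝ≥0∞ :=
  if p = ∞ then A.sup X else (∑ a ∈ A, X a ^ p.toReal) ^ (1 / p.toReal)

lemma lpSum_mono {X Y : ι → ℝ≥0∞} (h : ∀ a ∈ A, X a ≤ Y a) : lpSum A p X ≤ lpSum A p Y := by
  unfold lpSum
  split_ifs
  · exact Finset.sup_mono_fun h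
  · exact ENNReal.rpow_le_rpow (Finset.sum_le_sum fun a ha =>
      ENNReal.rpow_le_rpow (h a ha) ENNReal.toReal_nonneg) (by positivity)

lemma lpSum_add_le (hp : 1 ≤ p) (X Y : ι → ℝ≥0∞) :
    lpSum A p (fun a => X a + Y a) ≤ lpSum A p X + lpSum A p Y := by
  unfold lpSum
  split_ifs with h
  · exact Finset.sup_le fun a ha => add_le_add (Finset.le_sup ha) (Finset.le_sup ha)
  · exact ENNReal.Lp_add_le A X Y (by
      rwa [← ENNReal.toReal_one, ENNReal.toReal_le_toReal ENNReal.one_ne_top h])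

lemma lpSum_const_mul (hp : 1 ≤ p) (k : ℝ≥0∞) (X : ι → ℝ≥0∞) :
    lpSum A p (fun a => k * X a) = k * lpSum A p X := by
  unfold lpSum
  split_ifs with h
  · exact (Finset.apply_sup_eq_sup_comp_of_linearOrder (fun x => k * x)
      (fun _ _ h => mul_le_mul_right h k) (by simp)).symm
  · have hp0 : 0 < p.toReal := ENNReal.toReal_pos (zero_lt_one.trans_le hp).ne' h
    simp_rw [ENNReal.mul_rpow_of_nonneg _ _ hp0.le]
    rw [← Finset.mul_sum, ENNReal.mul_rpow_of_nonneg _ _ (by positivity), ← ENNReal.rpow_mul,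
      mul_one_div_cancel hp0.ne', ENNReal.rpow_one]

lemma le_lpSum (hp : 1 ≤ p) (X : ι → ℝ≥0∞) {a : ι} (ha : a ∈ A) : X a ≤ lpSum A p X := by
  unfold lpSum
  split_ifs with h
  · exact Finset.le_sup ha
  · have hp0 : 0 < p.toReal := ENNReal.toReal_pos (zero_lt_one.trans_le hp).ne' h
    calc X a = (X a ^ p.toReal) ^ (1 / p.toReal) := by
          rw [← ENNReal.rpow_mul, mul_one_div_cancel hp0.ne', ENNReal.rpow_one]
      _ ≤ _ := ENNReal.rpow_le_rpow
          (Finset.single_le_sum (f := fun a => X a ^ p.toReal) (fun _ _ => zero_le) ha)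
          (by positivity)

lemma lpSum_lt_top {X : ι → ℝ≥0∞} (h : ∀ a ∈ A, X a < ∞) : lpSum A p X < ∞ := by
  unfold lpSum
  split_ifs
  · exact (Finset.sup_lt_iff ENNReal.coe_lt_top).2 h
  · exact ENNReal.rpow_lt_top_of_nonneg (by positivity) (ENNReal.sum_lt_top.2 fun a ha =>
      ENNReal.rpow_lt_top_of_nonneg ENNReal.toReal_nonneg (h a ha).ne).ne

end sums

section gradient

variable {s n N : ℕ}

lemma sobolevSeminorm_eq_lpSum (k : ℕ) (p : ℝ≥0∞) (U : Set (E s)) (f : E s → E n) :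
    sobolevSeminorm k p U f = lpSum (multiIndices s k) p fun a => weakDerivNorm a p U f := rfl

lemma mem_multiIndices {k : ℕ} {a : Fin s → ℕ} : a ∈ multiIndices s k ↔ ∑ j, a j = k := by
  simp [multiIndices]

lemma mem_multiIndicesLE {k : ℕ} {a : Fin s → ℕ} : a ∈ multiIndicesLE s k ↔ ∑ j, a j ≤ k := by
  simp [multiIndicesLE, mem_multiIndices]

/-- On a `C^k` function the weak derivative for a multi-index of order `k` is the iterated Fréchet
derivative evaluated on a fixed family of basis vectors. -/
lemma exists_hasWeakDeriv_iteratedFDeriv {U : Set (E s)} (hU : IsOpen U) {a : Fin s → ℕ} {k : ℕ}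
    (ha : ∑ j, a j = k) : ∃ t : Fin k → Fin s, ∀ f : E s → E n, ContDiffOn ℝ k f U →
      HasWeakDeriv a U f fun x =>
        iteratedFDeriv ℝ k f x fun i => EuclideanSpace.single (t i) 1 := by
  have hl : (multiList a).reverse.length = k := by rw [List.length_reverse, length_multiList, ha]
  refine ⟨fun i => (multiList a).reverse.get (Fin.cast hl.symm i), fun f hf => ?_⟩
  refine (hasWeakDeriv_of_contDiffOn hU a (by rwa [ha])).congr (ae_eq_refl _) ?_
  rw [Filter.EventuallyEq, ae_restrict_iff' hU.measurableSet]
  exact Filter.Eventually.of_forall fun x hx =>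
    listDeriv_eq_iteratedFDeriv_of_length hU _ hl hf hx

lemma eLpNorm_partial_le_sobolevSeminorm {U : Set (E s)} (hU : IsOpen U) {f : E s → E n}
    (hf : ContDiffOn ℝ 1 f U) {p : ℝ≥0∞} (hp : 1 ≤ p) (j : Fin s) :
    eLpNorm (fun x => fderiv ℝ f x (EuclideanSpace.single j 1)) p (volume.restrict U) ≤
      sobolevSeminorm 1 p U f := by
  have hw := hasWeakDeriv_of_contDiffOn hU (Pi.single j 1) (f := f) (by simpa using hf)
  rw [multiList_single] at hw
  rw [sobolevSeminorm_eq_lpSum]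
  refine le_trans (weakDerivNorm_eq hU hw p).ge (le_lpSum hp _ ?_)
  simp [mem_multiIndices]

/-- All derivatives of order between `1` and `m` of the interpolating function are controlled by its
first-order Sobolev seminorm. The map sending nodal values to gradients has a bounded right inverse
on its finite-dimensional range, and replacing nodal values by others with the same gradient does
not change the derivatives. -/
lemma exists_enorm_iteratedFDeriv_euclInterp_le {T : Set (E s)} (hTo : IsOpen T)
    (hT : Bornology.IsBounded T) (φ : Fin N → MvPolynomial (Fin s) ℝ) (m : ℕ) {q : ℝ≥0∞}
    (hq : 1 ≤ q) :
    ∃ K : ℝ≥0, ∀ (c : Fin N → E n), ∀ x ∈ T, ∀ i, 1 ≤ i → i ≤ m →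
      ‖iteratedFDeriv ℝ i (euclInterp φ c) x‖ₑ ≤ K * sobolevSeminorm 1 q T (euclInterp φ c) := by
  have : Fact (1 ≤ q) := ⟨hq⟩
  have hfin : IsFiniteMeasure (volume.restrict T) := ⟨by
    rw [Measure.restrict_apply_univ]; exact hT.measure_lt_top⟩
  set D : (Fin N → E n) → Fin s → E s → E n := fun c j x =>
    fderiv ℝ (euclInterp φ c) x (EuclideanSpace.single j 1) with hDdef
  have hDc : ∀ c j, Continuous (D c j) := fun c j =>
    ((contDiff_euclInterp φ c (k := 1)).continuous_fderiv one_ne_zero).clm_apply continuous_const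
  obtain ⟨K₁, hK₁⟩ := exists_norm_iteratedFDeriv_euclInterp_le (n := n) hT φ (m + 1)
  have hDm : ∀ c j, MemLp (D c j) q (volume.restrict T) := by
    intro c j
    refine MemLp.of_bound (hDc c j).aestronglyMeasurable (K₁ * ‖c‖) ?_
    refine ae_restrict_of_forall_mem hTo.measurableSet fun x hx => ?_
    have h1 := hK₁ c x hx 1 (by omega)
    rw [← zero_add 1, ← norm_iteratedFDeriv_fderiv, norm_iteratedFDeriv_zero] at h1
    refine ((fderiv ℝ (euclInterp φ c) x).le_opNorm _).trans ?_
    simpa using h1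
  have hadd : ∀ c c' j, D (c + c') j = D c j + D c' j := by
    intro c c' j
    ext1 x
    simp only [hDdef, Pi.add_apply]
    simp only [fderiv_euclInterp, Pi.add_apply, smul_add, Finset.sum_add_distrib]
  have hsmul : ∀ (b : ℝ) c j, D (b • c) j = b • D c j := by
    intro b c j
    ext1 x
    simp only [hDdef, Pi.smul_apply]
    simp only [fderiv_euclInterp, Pi.smul_apply, Finset.smul_sum]
    exact Finset.sum_congr rfl fun i _ => smul_comm _ _ _
  let G : (Fin N → E n) →ₗ[ℝ] (Fin s → Lp (E n) q (volume.restrict T)) :=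
    { toFun := fun c j => (hDm c j).toLp
      map_add' := fun c c' => by
        funext j
        rw [Pi.add_apply, ← MemLp.toLp_add]
        simp only [hadd]
      map_smul' := fun b c => by
        funext j
        rw [RingHom.id_apply, Pi.smul_apply, ← MemLp.toLp_const_smul]
        simp only [hsmul] }
  obtain ⟨K₂, hK₂⟩ := exists_bounded_preimage G
  refine ⟨K₁ * K₂, fun c x hx i hi him => ?_⟩
  obtain ⟨c', hc', hcn⟩ := hK₂ c
  have hgrad : ∀ j, Set.EqOn (D c' j) (D c j) T := by
    intro j
    have h1 : (hDm c' j).toLp = (hDm c j).toLp := congrFun hc' j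
    exact Measure.eqOn_open_of_ae_eq ((MemLp.toLp_eq_toLp_iff _ _).1 h1) hTo
      (hDc c' j).continuousOn (hDc c j).continuousOn
  have hfd : ∀ y ∈ T, fderiv ℝ (euclInterp φ c') y = fderiv ℝ (euclInterp φ c) y := by
    intro y hy
    refine ContinuousLinearMap.coe_injective ((EuclideanSpace.basisFun (Fin s) ℝ).toBasis.ext
      fun j => ?_)
    simpa [hDdef] using hgrad j hy
  obtain ⟨k, rfl⟩ : ∃ k, i = k + 1 := ⟨i - 1, by omega⟩
  have heq : ‖iteratedFDeriv ℝ (k + 1) (euclInterp φ c) x‖ =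
      ‖iteratedFDeriv ℝ (k + 1) (euclInterp φ c') x‖ := by
    rw [← norm_iteratedFDeriv_fderiv, ← norm_iteratedFDeriv_fderiv]
    have : fderiv ℝ (euclInterp φ c) =ᶠ[nhds x] fderiv ℝ (euclInterp φ c') := by
      filter_upwards [hTo.mem_nhds hx] with y hy using (hfd y hy).symm
    rw [(this.iteratedFDeriv ℝ k).eq_of_nhds]
  have hGn : ‖G c‖ₑ ≤ sobolevSeminorm 1 q T (euclInterp φ c) := by
    rw [enorm_eq_nnnorm, Pi.nnnorm_def, ENNReal.coe_finset_sup]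
    refine Finset.sup_le fun j _ => ?_
    rw [← enorm_eq_nnnorm]
    change ‖(hDm c j).toLp‖ₑ ≤ _
    rw [Lp.enorm_toLp]
    exact eLpNorm_partial_le_sobolevSeminorm hTo (contDiff_euclInterp φ c).contDiffOn hq j
  calc ‖iteratedFDeriv ℝ (k + 1) (euclInterp φ c) x‖ₑ
      = ENNReal.ofReal ‖iteratedFDeriv ℝ (k + 1) (euclInterp φ c') x‖ := by
        rw [← ofReal_norm, heq]
    _ ≤ ENNReal.ofReal (K₁ * (K₂ * ‖G c‖)) := ENNReal.ofReal_le_ofReal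
        ((hK₁ c' x hx (k + 1) (by omega)).trans (mul_le_mul_of_nonneg_left hcn K₁.coe_nonneg))
    _ = (K₁ * K₂ : ℝ≥0) * ‖G c‖ₑ := by
        rw [ENNReal.ofReal_mul K₁.coe_nonneg, ENNReal.ofReal_mul K₂.coe_nonneg,
          ofReal_norm, ENNReal.ofReal_coe_nnreal, ENNReal.ofReal_coe_nnreal,
          ENNReal.coe_mul, mul_assoc]
    _ ≤ _ := by gcongr

end gradient

/-! ### Derivatives of the projected function -/

section projected

variable {s n : ℕ}

/-- The derivatives of order `m` of `P ∘ f` and of `f` compared at a point: the derivative of `P` at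
`f x` is close to the one at `P (f x) ∈ M`, which is an orthogonal projection. -/
lemma norm_iteratedFDeriv_projection_comp_le {M : Set (E n)} {δ : ℝ} (hδ : 0 < δ)
    {P : E n → E n} (hP : IsClosestPointProjection M (Metric.thickening δ M) P) {m : ℕ}
    (hm : 1 ≤ m) {B : ℝ} (hB0 : 0 ≤ B) {κ : ℝ} (hκ0 : 0 ≤ κ)
    (hPm : ContDiffOn ℝ m P (Metric.thickening δ M))
    (hPB : ∀ j ≤ m, ∀ q ∈ Metric.thickening δ M, ‖iteratedFDeriv ℝ j P q‖ ≤ (n : ℝ) ^ j * B)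
    (hPL : ∀ q q', segment ℝ q q' ⊆ Metric.thickening δ M →
      ‖fderiv ℝ P q' - fderiv ℝ P q‖ ≤ κ * B * ‖q' - q‖)
    {f : E s → E n} {x : E s} (hf : ContDiffAt ℝ m f x) (hfx : f x ∈ Metric.thickening δ M)
    {z : E n} (hz : z ∈ M) {σ a : ℝ} (hσ : ‖f x - z‖ ≤ σ) (ha : 0 ≤ a)
    (hD : ∀ i, 1 ≤ i → i ≤ m → ‖iteratedFDeriv ℝ i f x‖ ≤ a) (v : Fin m → E s)
    (hv : ∀ i, ‖v i‖ = 1) :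
    ‖iteratedFDeriv ℝ m (P ∘ f) x v‖ ≤ (1 + κ * B * σ) * ‖iteratedFDeriv ℝ m f x v‖ +
      Fintype.card (OrderedFinpartition m) * ((n + 1 : ℝ) ^ m * B * (a * max a (a ^ m))) := by
  set U := Metric.thickening δ M
  have hU : IsOpen U := Metric.isOpen_thickening
  have hMU : M ⊆ U := Metric.self_subset_thickening hδ M
  have hPx := hP.mem hfx
  have hm1 : (m : WithTop ℕ∞) ≠ 0 := by exact_mod_cast (by omega : m ≠ 0)
  have hgat : ContDiffAt ℝ m P (f x) := hPm.contDiffAt (hU.mem_nhds hfx)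
  have hlin : ‖fderiv ℝ P (f x) (iteratedFDeriv ℝ m f x v)‖ ≤
      (1 + κ * B * σ) * ‖iteratedFDeriv ℝ m f x v‖ := by
    set w := iteratedFDeriv ℝ m f x v
    have h1 := hP.norm_fderiv_apply_le hU hMU hPx.1
      ((hPm.contDiffAt (hU.mem_nhds (hMU hPx.1))).differentiableAt hm1) w
    have h2 : ‖fderiv ℝ P (f x) - fderiv ℝ P (P (f x))‖ ≤ κ * B * σ := by
      refine (hPL _ _ (hP.segment_subset hfx)).trans ?_
      have h3 := hPx.2 z hz
      rw [norm_sub_rev z, norm_sub_rev] at h3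
      exact mul_le_mul_of_nonneg_left (h3.trans hσ) (by positivity)
    calc ‖fderiv ℝ P (f x) w‖ = ‖fderiv ℝ P (P (f x)) w +
          (fderiv ℝ P (f x) - fderiv ℝ P (P (f x))) w‖ := by simp
      _ ≤ ‖w‖ + κ * B * σ * ‖w‖ := norm_add_le_of_le h1
          (ContinuousLinearMap.le_of_opNorm_le _ h2 w)
      _ = _ := by ring
  have hrem := norm_iteratedFDeriv_comp_sub_le hm hgat hf ha (B := (n + 1 : ℝ) ^ m * B)
    (by positivity) (fun j hj => (hPB j hj _ hfx).trans (mul_le_mul_of_nonneg_right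
      ((pow_le_pow_left₀ (by positivity) (by linarith) j).trans
        (pow_le_pow_right₀ (by linarith [(Nat.cast_nonneg n : (0 : ℝ) ≤ n)]) hj)) hB0)) hD
  set R := iteratedFDeriv ℝ m (P ∘ f) x -
    (fderiv ℝ P (f x)).compContinuousMultilinearMap (iteratedFDeriv ℝ m f x) with hR
  have hRv : ‖R v‖ ≤ ‖R‖ := by
    refine (R.le_opNorm v).trans ?_
    simp [hv]
  have hsplit : iteratedFDeriv ℝ m (P ∘ f) x v =
      fderiv ℝ P (f x) (iteratedFDeriv ℝ m f x v) + R v := by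
    simp [hR]
  rw [hsplit]
  exact norm_add_le_of_le hlin (hRv.trans hrem)

/-- A bound `a` on the derivatives that is both a multiple of `ρ` and of `α` enters the remainder
at least twice: one factor `a` is estimated by `ρ` and the others by `α`. -/
lemma mul_max_le_of_le {K ρ a : ℝ≥0} {α : ℝ≥0∞} {m : ℕ} (hK : 1 ≤ K) (hm : 1 ≤ m)
    (haρ : a ≤ K * ρ) (haα : (a : ℝ≥0∞) ≤ K * α) :
    ((a * max a (a ^ m) : ℝ≥0) : ℝ≥0∞) ≤ (K ^ (m + 1) * ρ : ℝ≥0) * max (α ^ m) α := by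
  have hKm : K ≤ K ^ m := le_self_pow₀ hK (by omega)
  have h1 : (max a (a ^ m) : ℝ≥0) ≤ (K : ℝ≥0∞) ^ m * max (α ^ m) α := by
    rw [ENNReal.coe_max]
    refine max_le ?_ ?_
    · refine haα.trans (mul_le_mul' ?_ (le_max_right _ _))
      exact_mod_cast hKm
    · rw [ENNReal.coe_pow]
      refine (pow_le_pow_left₀ (by simp) haα m).trans ?_
      rw [mul_pow]
      exact mul_le_mul' le_rfl (le_max_left _ _)
  rw [ENNReal.coe_mul]
  refine (mul_le_mul' (ENNReal.coe_le_coe.2 haρ) h1).trans_eq ?_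
  push_cast
  ring

/-- If the derivatives of order `m` of `F` are dominated by those of `f` and a constant, so are the
Sobolev seminorms. -/
lemma sobolevSeminorm_le_of_pointwise {T : Set (E s)} (hT : IsOpen T) {m : ℕ} {p : ℝ≥0∞}
    (hp : 1 ≤ p) {F f : E s → E n} (hF : ContDiffOn ℝ m F T) (hf : ContDiffOn ℝ m f T)
    {k R : ℝ≥0}
    (h : ∀ x ∈ T, ∀ t : Fin m → Fin s,
      ‖iteratedFDeriv ℝ m F x fun i => EuclideanSpace.single (t i) 1‖ ≤
        k * ‖iteratedFDeriv ℝ m f x fun i => EuclideanSpace.single (t i) 1‖ + R) :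
    sobolevSeminorm m p T F ≤ k * sobolevSeminorm m p T f +
      R * lpSum (multiIndices s m) p
        (fun _ => eLpNorm (fun _ : E s => (1 : ℝ)) p (volume.restrict T)) := by
  rw [sobolevSeminorm_eq_lpSum, sobolevSeminorm_eq_lpSum, ← lpSum_const_mul hp,
    ← lpSum_const_mul hp]
  refine le_trans (lpSum_mono fun a ha => ?_) (lpSum_add_le hp _ _)
  obtain ⟨t, ht⟩ := exists_hasWeakDeriv_iteratedFDeriv (n := n) hT (mem_multiIndices.1 ha)
  have hwf := ht f hf
  rw [weakDerivNorm_eq hT (ht F hF), weakDerivNorm_eq hT hwf]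
  set g := fun x => iteratedFDeriv ℝ m f x fun i => EuclideanSpace.single (t i) (1 : ℝ) with hg
  have hgm : AEStronglyMeasurable g (volume.restrict T) := hwf.locInt_deriv.aestronglyMeasurable
  calc _ ≤ eLpNorm ((fun x => (k : ℝ) • ‖g x‖) + fun _ => (R : ℝ) • (1 : ℝ)) p
        (volume.restrict T) := by
        refine eLpNorm_mono_ae_real (ae_restrict_of_forall_mem hT.measurableSet fun x hx => ?_)
        simpa using h x hx t
    _ ≤ eLpNorm (fun x => (k : ℝ) • ‖g x‖) p (volume.restrict T) +
        eLpNorm (fun _ : E s => (R : ℝ) • (1 : ℝ)) p (volume.restrict T) :=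
        eLpNorm_add_le (hgm.norm.const_mul (k : ℝ)) aestronglyMeasurable_const hp
    _ = k * eLpNorm g p (volume.restrict T) +
        R * eLpNorm (fun _ : E s => (1 : ℝ)) p (volume.restrict T) := by
        have e1 := eLpNorm_const_smul (k : ℝ) (fun x => ‖g x‖) p (volume.restrict T)
        have e2 := eLpNorm_const_smul (R : ℝ) (fun _ : E s => (1 : ℝ)) p (volume.restrict T)
        have hk : ‖(k : ℝ)‖ₑ = k := by simp
        have hR : ‖(R : ℝ)‖ₑ = R := by simp
        rw [hk, eLpNorm_norm] at e1
        rw [hR] at e2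
        exact congrArg₂ (· + ·) e1 e2

end projected

end

end ProjFE

open MeasureTheory ProjFE

theorem proposition2p3 (n m : ℕ) (hm : 1 ≤ m) :
    ∃ L : ℝ≥0 → ℝ≥0,
      ∀ (s r N : ℕ) (p : ℝ≥0∞) (T : Set (ProjFE.E s)) (ξ : Fin N → ProjFE.E s)
        (φ : Fin N → MvPolynomial (Fin s) ℝ),
        1 ≤ p → ProjFE.IsLipschitzDomain T → ProjFE.IsLagrangeBasis T r ξ φ →
        ∃ C : ℝ≥0,
          ∀ (M : Set (ProjFE.E n)) (δ : ℝ) (P : ProjFE.E n → ProjFE.E n) (ρ : ℝ≥0)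
            (z : ProjFE.E n) (c : Fin N → ProjFE.E n),
            IsClosed M → ProjFE.IsEmbeddedSubmanifold M → 0 < δ →
            ProjFE.IsClosestPointProjection M (Metric.thickening δ M) P →
            ProjFE.MemSobolev (m + 1) ∞ (Metric.thickening δ M) P →
            z ∈ M → (∀ i, c i ∈ ProjFE.geodesicBall M z ρ) →
            Set.MapsTo (ProjFE.euclInterp φ c) T (Metric.thickening δ M) →
            ProjFE.sobolevSeminorm m p T (ProjFE.projInterp P φ c) ≤
              ProjFE.sobolevSeminorm m p T (ProjFE.euclInterp φ c) +
                (C * ρ * L (ProjFE.sobolevNorm (m + 1) ∞ (Metric.thickening δ M) P).toNNReal :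
                    ℝ≥0∞) *
                  (ProjFE.sobolevSeminorm m p T (ProjFE.euclInterp φ c) +
                    max (ProjFE.sobolevSeminorm 1 (m * p) T (ProjFE.euclInterp φ c) ^ m)
                      (ProjFE.sobolevSeminorm 1 (m * p) T (ProjFE.euclInterp φ c))) := by
  refine ⟨id, fun s r N p T ξ φ hp hT hφ => ?_⟩
  have hTo := hT.isOpen
  have hTb := hT.isBounded
  have hmp : 1 ≤ (m : ℝ≥0∞) * p := one_le_mul (by exact_mod_cast hm) hp
  obtain ⟨K₀, hK₀⟩ := exists_norm_iteratedFDeriv_euclInterp_le (n := n) hTb φ m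
  obtain ⟨K₁, hK₁⟩ := exists_enorm_iteratedFDeriv_euclInterp_le (n := n) hTo hTb φ m hmp
  set K : ℝ≥0 := max 1 (max K₀ K₁) with hK
  have hK1 : 1 ≤ K := le_max_left _ _
  have hK₀K : K₀ ≤ K := (le_max_left _ _).trans (le_max_right _ _)
  have hK₁K : K₁ ≤ K := (le_max_right _ _).trans (le_max_right _ _)
  have hfin : IsFiniteMeasure (volume.restrict T) := ⟨by
    rw [Measure.restrict_apply_univ]; exact hTb.measure_lt_top⟩
  set W : ℝ≥0∞ := lpSum (multiIndices s m) p
    (fun _ => eLpNorm (fun _ : E s => (1 : ℝ)) p (volume.restrict T)) with hW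
  have hWtop : W ≠ ∞ := (lpSum_lt_top fun _ _ => (memLp_const (1 : ℝ)).eLpNorm_lt_top).ne
  set κ : ℝ≥0 := n * (lipschitzExtensionConstant (E n) * n) with hκ
  set d : ℝ≥0 := Fintype.card (OrderedFinpartition m) * (n + 1) ^ m with hd
  refine ⟨κ * K + d * K ^ (m + 1) * W.toNNReal, ?_⟩
  intro M δ P ρ z c hM _ hδ hP hPS hz hc hmaps
  set U := Metric.thickening δ M with hU
  set B : ℝ≥0 := (sobolevNorm (m + 1) ∞ U P).toNNReal with hBdef
  have hUo : IsOpen U := Metric.isOpen_thickening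
  have hB : ∀ a : Fin n → ℕ, ∑ j, a j ≤ m + 1 → weakDerivNorm a ∞ U P ≤ B := by
    intro a ha
    rw [hBdef, ENNReal.coe_toNNReal (ne_of_lt hPS)]
    exact le_lpSum (A := multiIndicesLE n (m + 1)) (p := ∞) (by simp)
      (fun a => weakDerivNorm a ∞ U P) (mem_multiIndicesLE.2 ha)
  obtain ⟨hPm, hPB, hPL⟩ := contDiffOn_of_weakDerivNorm_le hUo (hP.continuousOn hM) hB
  set f := euclInterp φ c with hf
  have hfc : ContDiff ℝ m f := contDiff_euclInterp φ c
  set α := sobolevSeminorm 1 (m * p) T f with hα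
  -- Subtracting the centre `z` changes neither the derivatives nor the size of the bound.
  have hcz : ‖c - fun _ => z‖ ≤ ρ := by
    refine (pi_norm_le_iff_of_nonneg ρ.coe_nonneg).2 fun i => ?_
    exact norm_sub_le_of_mem_geodesicBall (hc i)
  have hfz : euclInterp φ (c - fun _ => z) = f - fun _ => z := by
    rw [euclInterp_sub, hφ.euclInterp_const]
  have hfρ : ∀ x ∈ T, ‖f x - z‖ ≤ K * ρ := by
    intro x hx
    have := hK₀ (c - fun _ => z) x hx 0 (by omega)
    rw [norm_iteratedFDeriv_zero, hfz] at this
    exact this.trans (mul_le_mul (by exact_mod_cast hK₀K) hcz (norm_nonneg _) K.coe_nonneg)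
  have hDρ : ∀ x ∈ T, ∀ i, 1 ≤ i → i ≤ m → ‖iteratedFDeriv ℝ i f x‖ ≤ K * ρ := by
    intro x hx i hi him
    have := hK₀ (c - fun _ => z) x hx i him
    have hconst : iteratedFDeriv ℝ i (fun _ : E s => z) x = 0 := by
      rw [iteratedFDeriv_const_of_ne (by omega)]; rfl
    rw [hfz, iteratedFDeriv_sub_apply (contDiff_euclInterp φ c).contDiffAt
      contDiff_const.contDiffAt, hconst, sub_zero] at this
    exact this.trans (mul_le_mul (by exact_mod_cast hK₀K) hcz (norm_nonneg _) K.coe_nonneg)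
  have hDα : ∀ x ∈ T, ∀ i, 1 ≤ i → i ≤ m → ‖iteratedFDeriv ℝ i f x‖ₑ ≤ K * α := by
    intro x hx i hi him
    exact (hK₁ c x hx i hi him).trans (mul_le_mul' (ENNReal.coe_le_coe.2 hK₁K) le_rfl)
  -- The minimum is finite even without knowing that `α` is.
  set a : ℝ≥0 := (min ((K * ρ : ℝ≥0) : ℝ≥0∞) (K * α)).toNNReal with ha
  have hatop : min ((K * ρ : ℝ≥0) : ℝ≥0∞) (K * α) ≠ ∞ :=
    ((min_le_left _ _).trans_lt ENNReal.coe_lt_top).ne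
  have haρ : a ≤ K * ρ := by
    rw [← ENNReal.coe_le_coe, ha, ENNReal.coe_toNNReal hatop]
    exact min_le_left _ _
  have haα : (a : ℝ≥0∞) ≤ K * α := by
    rw [ha, ENNReal.coe_toNNReal hatop]
    exact min_le_right _ _
  have hDa : ∀ x ∈ T, ∀ i, 1 ≤ i → i ≤ m → ‖iteratedFDeriv ℝ i f x‖ ≤ a := by
    intro x hx i hi him
    have h1 : ‖iteratedFDeriv ℝ i f x‖ₑ ≤ a := by
      rw [ha, ENNReal.coe_toNNReal hatop]
      refine le_min ?_ (hDα x hx i hi him)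
      rw [enorm_eq_nnnorm]
      exact_mod_cast hDρ x hx i hi him
    rw [enorm_eq_nnnorm] at h1
    exact_mod_cast h1
  have hpt := sobolevSeminorm_le_of_pointwise (p := p) hTo hp (F := P ∘ f) (f := f)
    (hPm.comp hfc.contDiffOn hmaps) hfc.contDiffOn (k := 1 + κ * B * (K * ρ))
    (R := d * B * (a * max a (a ^ m))) (fun x hx t => by
      refine (norm_iteratedFDeriv_projection_comp_le hδ hP hm B.coe_nonneg κ.coe_nonneg hPm hPB
        (fun q q' hq => ?_) hfc.contDiffAt (hmaps hx) hz (hfρ x hx) a.coe_nonneg (hDa x hx)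
        _ (fun i => by simp)).trans_eq ?_
      · refine (hPL hm q q' hq).trans_eq ?_
        rw [hκ]; push_cast; ring
      · rw [hd]; push_cast; ring)
  refine hpt.trans ?_
  have hrem := mul_max_le_of_le hK1 hm haρ haα
  have hRW : ((d * B * (a * max a (a ^ m)) : ℝ≥0) : ℝ≥0∞) * W ≤
      (d * K ^ (m + 1) * W.toNNReal : ℝ≥0) * (ρ * B) * max (α ^ m) α := by
    rw [ENNReal.coe_mul]
    calc _ ≤ ((d * B : ℝ≥0) : ℝ≥0∞) * ((K ^ (m + 1) * ρ : ℝ≥0) * max (α ^ m) α) * W := by gcongr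
      _ = _ := by
        conv_lhs => rw [← ENNReal.coe_toNNReal hWtop]
        push_cast; ring
  set S := sobolevSeminorm m p T f
  refine (add_le_add le_rfl hRW).trans ?_
  have hring : S + (((κ * K + d * K ^ (m + 1) * W.toNNReal : ℝ≥0) : ℝ≥0∞) * ρ * (id B : ℝ≥0)) *
      (S + max (α ^ m) α) = (((1 + κ * B * (K * ρ) : ℝ≥0) : ℝ≥0∞) * S +
        (d * K ^ (m + 1) * W.toNNReal : ℝ≥0) * (ρ * B) * max (α ^ m) α) +
      (((κ * K : ℝ≥0) : ℝ≥0∞) * ρ * B * max (α ^ m) α +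
        (d * K ^ (m + 1) * W.toNNReal : ℝ≥0) * ρ * B * S) := by
    simp only [id]
    push_cast
    ring
  exact le_self_add.trans_eq hring.symm
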